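/- Let $\mathcal A$ be an arrangement (a finite set) of linear hyperplanes in $\mathbb R^d$, let $\mathcal C(\mathcal A)$ be its set of chambers (the connected components of $\mathbb R^d\setminus\bigcup\mathcal A$), and fix a base chamber $C_0\in\mathcal C(\mathcal A)$. *Notation.* For chambers $C,C'$ let $S(C,C')\subseteq\mathcal A$ be the set of hyperplanes separating $C$ from $C'$; the chambers are adjacent if $|S(C,C')|=1$. The arrangement graph $G(\mathcal A)$ has the chambers as vertices and a pair of opposite oriented edges between any two adjacent chambers. A directed path on $G(\mathcal A)$ is positive minimal if it has minimal length among the directed paths with the same ends. The category of positive paths $\mathcal G^+(\mathcal A)$ is the quotient of the free category on $G(\mathcal A)$ by the relation identifying any two positive minimal paths with the same ends; write $\sim$ for the resulting equivalence of directed (positive) paths and $(C'\to C)$ for the class of the positive minimal paths from $C'$ to $C$. The arrangement groupoid $\mathcal G(\mathcal A)$ is obtained from $\mathcal G^+(\mathcal A)$ by formally inverting all morphisms. For a chamber $C$, the order of regions $\mathcal P_C$ on $\mathcal C(\mathcal A)$ is given by $C_1\le_C C_2$ if and only if $S(C,C_1)\subseteq S(C,C_2)$. *Property D (with base chamber $C_0$).*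 For every positive path $\gamma$ starting at $C_0$, ending at $C$ say, there is a chamber $C_\gamma$ such that for every chamber $C'$: one can write $\gamma\sim\gamma'(C'\to C)$ for some positive path $\gamma'$ from $C_0$ to $C'$ if and only if $C'\le_C C_\gamma$. *The complexes.* $\mathcal U(\mathcal A)$ is the simplicial complex whose vertices are the morphisms of $\mathcal G(\mathcal A)$ starting at $C_0$, and whose simplices are the sets $\{\gamma_1,\dots,\gamma_{k+1}\}$, $k\ge 0$, for which there are positive minimal $\alpha_1,\dots,\alpha_k$ with $\gamma_{i+1}=\gamma_i\alpha_i$ for $1\le i\le k$ and $\alpha_1\cdots\alpha_k$ positive minimal. $\mathcal U^+$ is the full subcomplex of $\mathcal U(\mathcal A)$ spanned by the vertices that are images of positive paths, i.e. of morphisms of $\mathcal G^+(\mathcal A)$. **Theorem.** If $\mathcal A$ satisfies property D with base chamber $C_0$, then (the geometric realization of) $\mathcal U^+$ is contractible. In particular, if $\mathcal A$ satisfies property D for every base chamber, then $\mathcal U^+$ is contractible for every choice of $C_0$. -/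

import Mathlib

open CategoryTheory

/-! ### Simplicial complexes: induced subcomplexes and geometric realization -/

namespace PreAbstractSimplicialComplex

/-- The full subcomplex of `K` spanned by the vertices in `S`. -/
def inducedOn {V : Type*} (K : PreAbstractSimplicialComplex V) (S : Set V) :
    PreAbstractSimplicialComplex V where
  faces := {s | s ∈ K.faces ∧ ∀ v ∈ s, v ∈ S}
  isRelLowerSet_faces := fun _ hs =>
    ⟨(K.isRelLowerSet_faces hs.1).1, fun _ hts ht =>
      ⟨(K.isRelLowerSet_faces hs.1).2 hts ht, fun v hv => hs.2 v (hts hv)⟩⟩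

/-- The points of the geometric realization `|K|`, in barycentric coordinates: finitely supported
nonnegative functions of total mass one whose support is a face of `K`. -/
def Realization {V : Type*} (K : PreAbstractSimplicialComplex V) : Type _ :=
  {f : V →₀ ℝ // (∀ v, 0 ≤ f v) ∧ (f.sum fun _ a => a) = 1 ∧ f.support ∈ K.faces}

/-- The inclusion of the closed simplex spanned by a face `s` into `|K|` (extension of barycentric
coordinates by zero). -/
noncomputable def simplexMap {V : Type*} (K : PreAbstractSimplicialComplex V) (s : Finset V)
    (hs : s ∈ K.faces) (x : stdSimplex ℝ s) : K.Realization :=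
  ⟨(Finsupp.equivFunOnFinite.symm (x : s → ℝ)).embDomain (Function.Embedding.subtype (· ∈ s)), by
    set g : s →₀ ℝ := Finsupp.equivFunOnFinite.symm (x : s → ℝ) with hg
    have hsum : (g.sum fun _ a => a) = 1 := by
      rw [Finsupp.sum_fintype _ _ (fun _ => rfl)]
      exact x.2.2
    refine ⟨fun v => ?_, ?_, ?_⟩
    · by_cases hv : v ∈ s
      · have := Finsupp.embDomain_apply_self (Function.Embedding.subtype (· ∈ s)) g ⟨v, hv⟩
        simp only [Function.Embedding.coe_subtype] at this
        rw [this]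
        exact x.2.1 _
      · rw [Finsupp.embDomain_of_notMem_range]
        simpa using hv
    · rw [Finsupp.sum_embDomain]
      exact hsum
    · refine (K.isRelLowerSet_faces hs).2 (fun v hv => ?_) ?_
      · rw [Finsupp.support_embDomain, Finset.mem_map] at hv
        obtain ⟨w, -, rfl⟩ := hv
        exact w.2
      · rw [Finsupp.support_embDomain, Finset.map_nonempty, Finsupp.support_nonempty_iff]
        intro h0
        rw [h0, Finsupp.sum_zero_index] at hsum
        exact zero_ne_one hsum⟩

/-- The weak topology on `|K|`: a set is open iff its trace on every closed simplex is open. -/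
noncomputable instance {V : Type*} (K : PreAbstractSimplicialComplex V) : TopologicalSpace K.Realization :=
  ⨆ s : K.faces, TopologicalSpace.coinduced (K.simplexMap s.1 s.2) inferInstance

end PreAbstractSimplicialComplex

/-! ### Arrangements, chambers and the arrangement graph -/

/-- An arrangement of linear hyperplanes in `ℝ^d`: a finite set of linear subspaces of
codimension one. -/
structure LinearArrangement (d : ℕ) where
  hyperplanes : Finset (Submodule ℝ (EuclideanSpace ℝ (Fin d)))
  finrank_add_one : ∀ H ∈ hyperplanes, Module.finrank ℝ H + 1 = d

namespace LinearArrangement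

/-- The complement of the arrangement in `ℝ^d`. -/
def complement {d : ℕ} (A : LinearArrangement d) : Set (EuclideanSpace ℝ (Fin d)) :=
  {x | ∀ H ∈ A.hyperplanes, x ∉ H}

/-- A chamber: a connected component of the complement. -/
@[ext]
structure Chamber {d : ℕ} (A : LinearArrangement d) where
  carrier : Set (EuclideanSpace ℝ (Fin d))
  isComponent : ∃ x ∈ A.complement, carrier = connectedComponentIn A.complement x

/-- The set `S(C, C')` of hyperplanes separating `C` from `C'`: those meeting the segment from a
point of `C` to a point of `C'` (the choice of the two points is immaterial). -/
def sep {d : ℕ} {A : LinearArrangement d} (C C' : A.Chamber) :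
    Set (Submodule ℝ (EuclideanSpace ℝ (Fin d))) :=
  {H | H ∈ A.hyperplanes ∧ ∃ p ∈ C.carrier, ∃ q ∈ C'.carrier, ∃ x ∈ segment ℝ p q, x ∈ H}

/-- Two chambers are adjacent if exactly one hyperplane separates them. -/
def Adjacent {d : ℕ} {A : LinearArrangement d} (C C' : A.Chamber) : Prop :=
  ∃ H, sep C C' = {H}

/-- The arrangement graph `G(A)`: one oriented edge `C ⟶ C'` for every ordered pair of adjacent
chambers. -/
instance arrangementGraph {d : ℕ} (A : LinearArrangement d) : Quiver A.Chamber where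
  Hom C C' := PLift (Adjacent C C')

/-- The order of regions with base chamber `B`: `C ≤_B C'` iff `S(B, C) ⊆ S(B, C')`. -/
def RegionLE {d : ℕ} {A : LinearArrangement d} (B C C' : A.Chamber) : Prop :=
  sep B C ⊆ sep B C'

/-! ### Positive paths and the arrangement groupoid -/

/-- A directed path is minimal if no directed path with the same ends is shorter. -/
def IsMinimal {d : ℕ} {A : LinearArrangement d} {C C' : A.Chamber} (p : Quiver.Path C C') : Prop :=
  ∀ q : Quiver.Path C C', p.length ≤ q.length

/-- The relation identifying any two positive minimal paths with the same ends. -/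
def minimalRel {d : ℕ} (A : LinearArrangement d) : HomRel (Paths A.Chamber) :=
  fun C C' p q => IsMinimal (A := A) (C := C) (C' := C') p ∧ IsMinimal (A := A) (C := C) (C' := C') q

/-- The category of positive paths `G⁺(A)`. -/
abbrev PosCat {d : ℕ} (A : LinearArrangement d) : Type :=
  CategoryTheory.Quotient A.minimalRel

/-- A chamber as an object of the category of positive paths. -/
def posObj {d : ℕ} {A : LinearArrangement d} (C : A.Chamber) : A.PosCat := ⟨C⟩

/-- The chamber underlying an object of the category of positive paths. -/
def PosCat.chamber {d : ℕ} {A : LinearArrangement d} (X : A.PosCat) : A.Chamber := X.as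

/-- The class in the category of positive paths of a directed path. -/
def posClass {d : ℕ} {A : LinearArrangement d} {C C' : A.Chamber} (p : Quiver.Path C C') :
    posObj C ⟶ posObj C' :=
  (CategoryTheory.Quotient.functor A.minimalRel).map (X := (C : Paths A.Chamber)) (Y := C') p

/-- A morphism of the category of positive paths is positive minimal if it is the class of a
positive minimal path. -/
def IsPosMin {d : ℕ} {A : LinearArrangement d} {X Y : A.PosCat} (f : X ⟶ Y) : Prop :=
  ∃ p : Quiver.Path X.chamber Y.chamber, IsMinimal p ∧ posClass p = f

/-- The arrangement groupoid `G(A)`, obtained from the category of positive paths by formally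
inverting all morphisms. -/
abbrev ArrGroupoid {d : ℕ} (A : LinearArrangement d) : Type :=
  FreeGroupoid A.PosCat

/-- The canonical functor from positive paths to the arrangement groupoid. -/
abbrev toGroupoid {d : ℕ} (A : LinearArrangement d) : A.PosCat ⥤ A.ArrGroupoid :=
  FreeGroupoid.of A.PosCat

/-- Property D, with base chamber `B`: for every positive path `γ` starting at `B` and ending at
`C`, there is a chamber `Cγ` such that `γ ∼ γ'(C' → C)` for some positive path `γ'` if and only if
`C' ≤ Cγ` in the order of regions based at `C`. -/
def PropertyD {d : ℕ} (A : LinearArrangement d) (B : A.Chamber) : Prop :=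
  ∀ (C : A.Chamber) (γ : posObj B ⟶ posObj C), ∃ Cγ : A.Chamber, ∀ C' : A.Chamber,
    (∃ (γ' : posObj B ⟶ posObj C') (μ : posObj C' ⟶ posObj C), IsPosMin μ ∧ γ = γ' ≫ μ) ↔
      RegionLE C C' Cγ

/-! ### Helper facts: factors of positive minimal morphisms are positive minimal -/

theorem length_eq_of_posClass_eq {d : ℕ} {A : LinearArrangement d} {C C' : A.Chamber}
    {p q : Quiver.Path C C'} (h : posClass p = posClass q) : p.length = q.length := by
  have h' : Relation.EqvGen (@HomRel.CompClosure _ _ A.minimalRel C C') p q :=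
    Quot.eqvGen_exact h
  have aux : ∀ {a b : A.Chamber} (f : Quiver.Path C a) (m₁ m₂ : Quiver.Path a b)
      (g : Quiver.Path b C'), m₁.length = m₂.length →
        (f.comp (m₁.comp g)).length = (f.comp (m₂.comp g)).length := by
    intro a b f m₁ m₂ g e
    simp only [Quiver.Path.length_comp, e]
  induction h' with
  | rel x y hxy =>
    obtain ⟨a, b, f, m₁, m₂, g, hm⟩ := hxy
    have e : Quiver.Path.length (V := A.Chamber) m₁ = Quiver.Path.length (V := A.Chamber) m₂ :=
      le_antisymm (hm.1 _) (hm.2 _)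
    exact aux f m₁ m₂ g e
  | refl x => rfl
  | symm x y _ ih => exact (ih (Quot.eqvGen_sound ‹_›)).symm
  | trans x y z _ _ ih₁ ih₂ =>
    exact (ih₁ (Quot.eqvGen_sound ‹_›)).trans (ih₂ (Quot.eqvGen_sound ‹_›))

theorem exists_posClass {d : ℕ} {A : LinearArrangement d} {X Y : A.PosCat} (f : X ⟶ Y) :
    ∃ p : Quiver.Path X.chamber Y.chamber, posClass p = f :=
  Quot.exists_rep f

theorem posClass_comp {d : ℕ} {A : LinearArrangement d} {C C' C'' : A.Chamber}
    (p : Quiver.Path C C') (q : Quiver.Path C' C'') :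
    posClass (p.comp q) = posClass p ≫ posClass q := rfl

theorem isPosMin_of_comp {d : ℕ} {A : LinearArrangement d} {X Y Z : A.PosCat} (f : X ⟶ Y)
    (g : Y ⟶ Z) (h : IsPosMin (f ≫ g)) : IsPosMin f ∧ IsPosMin g := by
  obtain ⟨p, rfl⟩ := exists_posClass f
  obtain ⟨q, rfl⟩ := exists_posClass g
  obtain ⟨r, hr, hrc⟩ := h
  have hl : r.length = (p.comp q).length := length_eq_of_posClass_eq hrc
  rw [Quiver.Path.length_comp] at hl
  refine ⟨⟨p, fun p' => ?_, rfl⟩, ⟨q, fun q' => ?_, rfl⟩⟩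
  · have := hr (p'.comp q)
    rw [Quiver.Path.length_comp] at this
    omega
  · have := hr (p.comp q')
    rw [Quiver.Path.length_comp] at this
    omega

/-! ### The complexes `U` and `U⁺` -/

/-- The vertices of `U`: all morphisms of the arrangement groupoid starting at `B`. -/
abbrev UVertex {d : ℕ} {A : LinearArrangement d} (B : A.Chamber) : Type :=
  Σ X : A.PosCat, (A.toGroupoid.obj (posObj B) ⟶ A.toGroupoid.obj X)

/-- Given `α₁, …, αₙ` (a string `F` of `n` composable morphisms of the category of positive paths)
and a morphism `γ` from `B` to the source of `α₁`, the vertex `γ α₁ ⋯ αᵢ` of `U`. -/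
def stringVertex {d : ℕ} {A : LinearArrangement d} {B : A.Chamber} {n : ℕ}
    (F : ComposableArrows A.PosCat n)
    (γ : A.toGroupoid.obj (posObj B) ⟶ A.toGroupoid.obj (F.obj 0)) (i : Fin (n + 1)) : UVertex B :=
  ⟨F.obj i, γ ≫ A.toGroupoid.map (F.map (homOfLE (Fin.zero_le i)))⟩

/-- The simplicial complex `U(A)` with base chamber `B`: the simplices are the sets
`{γ, γ α₁, …, γ α₁ ⋯ αₙ}` with all `αᵢ` and the product `α₁ ⋯ αₙ` positive minimal. -/
def UComplex {d : ℕ} (A : LinearArrangement d) (B : A.Chamber) :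
    PreAbstractSimplicialComplex (UVertex B) where
  faces := {s | ∃ (n : ℕ) (F : ComposableArrows A.PosCat n)
    (γ : A.toGroupoid.obj (posObj B) ⟶ A.toGroupoid.obj (F.obj 0)),
    (∀ i : Fin n, IsPosMin (F.map (homOfLE (Fin.castSucc_lt_succ (i := i)).le))) ∧
    IsPosMin (F.map (homOfLE (Fin.zero_le (Fin.last n)))) ∧
    (s : Set (UVertex B)) = Set.range (stringVertex F γ)}
  isRelLowerSet_faces := by
    classical
    rintro s ⟨n, F, γ, -, hF, hs⟩
    have key : ∀ i j : Fin (n + 1), ∀ h : i ≤ j, IsPosMin (F.map (homOfLE h)) := by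
      intro i j h
      have e : F.map (homOfLE (Fin.zero_le (Fin.last n))) =
          F.map (homOfLE (Fin.zero_le i)) ≫ F.map (homOfLE h) ≫
            F.map (homOfLE (Fin.le_last j)) := by
        rw [← F.map_comp, ← F.map_comp]; rfl
      rw [e] at hF
      exact (isPosMin_of_comp _ _ (isPosMin_of_comp _ _ hF).2).1
    refine ⟨?_, fun t hts ht => ?_⟩
    · rw [← Finset.coe_nonempty, hs]
      exact Set.range_nonempty _
    · set J : Finset (Fin (n + 1)) := Finset.univ.filter fun i => stringVertex F γ i ∈ t with hJ
      have hJne : J.Nonempty := by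
        obtain ⟨v, hv⟩ := ht
        have : v ∈ (s : Set (UVertex B)) := hts hv
        rw [hs] at this
        obtain ⟨i, rfl⟩ := this
        exact ⟨i, by simpa [hJ] using hv⟩
      obtain ⟨k, hk⟩ : ∃ k, J.card = k + 1 := ⟨J.card - 1, by have := hJne.card_pos; omega⟩
      let e := J.orderEmbOfFin hk
      refine ⟨k, e.monotone.functor ⋙ F, γ ≫ A.toGroupoid.map (F.map (homOfLE (Fin.zero_le (e 0)))),
        fun i => key _ _ _, key _ _ _, ?_⟩
      have hv : ∀ j, stringVertex (B := B) (e.monotone.functor ⋙ F : ComposableArrows A.PosCat k)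
          (γ ≫ A.toGroupoid.map (F.map (homOfLE (Fin.zero_le (e 0))))) j =
            stringVertex F γ (e j) := by
        intro j
        refine Sigma.ext rfl (heq_of_eq ?_)
        change (γ ≫ A.toGroupoid.map (F.map (homOfLE (Fin.zero_le (e 0))))) ≫
          A.toGroupoid.map (F.map (homOfLE (e.monotone (Fin.zero_le j)))) = _
        rw [Category.assoc, ← A.toGroupoid.map_comp, ← F.map_comp]
        rfl
      ext v
      constructor
      · intro hvt
        have : v ∈ (s : Set (UVertex B)) := hts hvt
        rw [hs] at this
        obtain ⟨i, rfl⟩ := this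
        have hi : i ∈ (J : Set (Fin (n + 1))) := by simpa [hJ] using hvt
        rw [← Finset.range_orderEmbOfFin J hk] at hi
        obtain ⟨j, rfl⟩ := hi
        exact ⟨j, hv j⟩
      · rintro ⟨j, rfl⟩
        rw [hv]
        have := Finset.orderEmbOfFin_mem J hk j
        exact Finset.mem_coe.2 (Finset.mem_filter.1 this).2

/-- The vertices of `U` that correspond to positive paths. -/
def positiveVertices {d : ℕ} {A : LinearArrangement d} (B : A.Chamber) : Set (UVertex B) :=
  {v | ∃ f : posObj B ⟶ v.1, A.toGroupoid.map f = v.2}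

/-- The subcomplex `U⁺` of `U(A)` spanned by the vertices that correspond to positive paths. -/
def UPlus {d : ℕ} (A : LinearArrangement d) (B : A.Chamber) :
    PreAbstractSimplicialComplex (UVertex B) :=
  (A.UComplex B).inducedOn (positiveVertices B)

end LinearArrangement

/-!
The complex `U⁺` is contracted by removing final segments of positive paths. Property D provides,
for each positive path `γ` from the base chamber, a factorization `γ = γ'(C' → C)` with a greatest
positive minimal right factor; let `φ γ = γ'`. Write `Rel p q` if `q = p μ` with `μ` positive
minimal. The faces of `U⁺` are the finite nonempty sets of positive paths that are pairwise related
(`mem_faces_UPlus_iff`), and `φ` satisfies: `Rel (φ p) p`, and `Rel q p` implies `Rel (φ p) q`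
(`PosPath.beheaded_rel_of_rel`), whence `φ` preserves `Rel`. For a face `γ₁, …, γₖ`, ordered by
length, the sets `{γ₁, …, γⱼ, φ γⱼ, …, φ γₖ}` are therefore faces, although in general the union of
the face and its image is not. These are the simplices of the standard triangulation of a prism, so
`φ` is homotopic to the identity (`isPrismatic_beheadVertex`). As `φ` shortens all nontrivial
paths, its iterates carry each vertex to the trivial path at the base chamber, and the infinite
concatenation of the homotopies between successive iterates is a contraction
(`PreAbstractSimplicialComplex.IsPrismatic.contractibleSpace`).

For this to make sense on the vertices of `U⁺`, which are morphisms of the arrangement groupoid,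
positive paths from the base chamber must embed into the groupoid. There are two steps. First,
property D implies that such paths can be cancelled on the right (`PropertyD.cancel`): by induction
on the length, every path that ends with an edge `D → E` and represents a given class
`a(X → E)`, with `X` the greatest chamber for this class, has initial part `a(X → D)`, because this
is invariant under the elementary relations. Secondly, the full twists `C → -C → C` are natural in
the category of positive paths and divisible by all edges, so the arrangement groupoid is a
category of left fractions (`hasLeftCalculusOfFractions`), and two positive paths with the same
image become equal after some positive path is appended to both.

The geometry of the arrangement enters only through the sets `sep C D`: they satisfy
`sep C E = sep C D ∆ sep D E`, they are empty only for `C = D`, every chamber has an opposite, and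
for `C ≠ D` some chamber adjacent to `C` is separated from it by a hyperplane of `sep C D`, as the
segment from `C` to a generic point of `D` shows (`exists_adjacent_of_ne`). Hence the positive
minimal paths from `C` to `D` are those of length `|sep C D|`, and `(C → D)(D → E) = (C → E)`
if and only if `D` lies between `C` and `E`.
-/

/-! ### Continuous maps into and out of geometric realizations -/

namespace PreAbstractSimplicialComplex

variable {V : Type*} {K : PreAbstractSimplicialComplex V}

theorem Realization.ext {x y : K.Realization} (h : ∀ v, x.1 v = y.1 v) : x = y :=
  Subtype.ext (Finsupp.ext h)

theorem continuous_simplexMap (s : Finset V) (hs : s ∈ K.faces) :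
    Continuous (K.simplexMap s hs) :=
  continuous_iff_coinduced_le.2 (le_iSup
    (fun s : K.faces => TopologicalSpace.coinduced (K.simplexMap s.1 s.2) inferInstance) ⟨s, hs⟩)

theorem continuous_of_continuous_simplexMap {Z : Type*} [TopologicalSpace Z]
    {f : K.Realization → Z} (h : ∀ s hs, Continuous (f ∘ K.simplexMap s hs)) : Continuous f :=
  continuous_iSup_dom.2 fun s => continuous_coinduced_dom.2 (h s.1 s.2)

theorem simplexMap_apply_mem {s : Finset V} (hs : s ∈ K.faces) (y : stdSimplex ℝ s) {v : V}
    (hv : v ∈ s) : (K.simplexMap s hs y).1 v = y ⟨v, hv⟩ :=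
  Finsupp.embDomain_apply_self (Function.Embedding.subtype (· ∈ s))
    (Finsupp.equivFunOnFinite.symm (y : s → ℝ)) ⟨v, hv⟩

theorem simplexMap_apply_notMem {s : Finset V} (hs : s ∈ K.faces) (y : stdSimplex ℝ s) {v : V}
    (hv : v ∉ s) : (K.simplexMap s hs y).1 v = 0 :=
  Finsupp.embDomain_of_notMem_range _ _ _ (by simpa using hv)

theorem support_simplexMap_subset {s : Finset V} (hs : s ∈ K.faces) (y : stdSimplex ℝ s) :
    (K.simplexMap s hs y).1.support ⊆ s := fun v hv => by
  by_contra h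
  exact Finsupp.mem_support_iff.1 hv (simplexMap_apply_notMem hs y h)

theorem Realization.sum_eq_one (x : K.Realization) {s : Finset V} (hx : x.1.support ⊆ s) :
    ∑ v ∈ s, x.1 v = 1 :=
  (Finsupp.sum_of_support_subset x.1 hx (fun _ a => a) (fun _ _ => rfl)).symm.trans x.2.2.1

theorem exists_simplexMap_eq (x : K.Realization) {s : Finset V} (hs : s ∈ K.faces)
    (hx : x.1.support ⊆ s) :
    K.simplexMap s hs ⟨fun v => x.1 v, fun v => x.2.1 v, by
      rw [Finset.sum_coe_sort s fun v => x.1 v]; exact x.sum_eq_one hx⟩ = x := by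
  refine Realization.ext fun v => ?_
  by_cases hv : v ∈ s
  · rw [simplexMap_apply_mem hs _ hv]; rfl
  · rw [simplexMap_apply_notMem hs _ hv]
    by_contra h
    exact hv (hx (Finsupp.mem_support_iff.2 (Ne.symm h)))

theorem continuous_of_support_subset_face {X : Type*} [TopologicalSpace X]
    {f : X → K.Realization} {s : Finset V} (hs : s ∈ K.faces) (hf : ∀ x, (f x).1.support ⊆ s)
    (hc : ∀ v, Continuous fun x => (f x).1 v) : Continuous f := by
  have : f = K.simplexMap s hs ∘ fun x => ⟨fun v => (f x).1 v, fun v => (f x).2.1 v, by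
      rw [Finset.sum_coe_sort s fun v => (f x).1 v]; exact (f x).sum_eq_one (hf x)⟩ :=
    funext fun x => (exists_simplexMap_eq (f x) hs (hf x)).symm
  rw [this]
  exact (continuous_simplexMap s hs).comp
    (Continuous.subtype_mk (continuous_pi fun v : s => hc v.1) _)

/-- Although `|K|` carries the weak topology, a map into it whose values are supported on a fixed
finite set of vertices is continuous as soon as its barycentric coordinates are. -/
theorem continuous_of_support_subset {X : Type*} [TopologicalSpace X]
    {f : X → K.Realization} (W : Finset V) (hf : ∀ x, (f x).1.support ⊆ W)
    (hc : ∀ v, Continuous fun x => (f x).1 v) : Continuous f := by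
  classical
  -- The sets on which the value lies in a given face form a finite closed cover.
  let T : {s : Finset V // s ∈ W.powerset} → Set X :=
    fun s => {x | s.1 ∈ K.faces ∧ ∀ v, v ∉ s.1 → (f x).1 v = 0}
  refine LocallyFinite.continuous (f := T) (locallyFinite_of_finite T) ?_ ?_ ?_
  · refine Set.eq_univ_of_forall fun x => Set.mem_iUnion.2
      ⟨⟨(f x).1.support, Finset.mem_powerset.2 (hf x)⟩, (f x).2.2.2, fun v hv => ?_⟩
    exact Finsupp.notMem_support_iff.1 hv
  · intro s
    have hT : T s = {_x | s.1 ∈ K.faces} ∩ ⋂ v, ⋂ (_ : v ∉ s.1), {x | (f x).1 v = 0} := by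
      ext x
      simp [T]
    rw [hT]
    exact isClosed_const.inter <| isClosed_iInter fun v => isClosed_iInter fun _ =>
      isClosed_eq (hc v) continuous_const
  · intro s
    by_cases hs : s.1 ∈ K.faces
    · rw [continuousOn_iff_continuous_domRestrict]
      refine continuous_of_support_subset_face hs (fun x v hv => ?_)
        fun v => (hc v).comp continuous_subtype_val
      by_contra h
      exact Finsupp.mem_support_iff.1 hv (x.2.2 v h)
    · intro x hx
      exact absurd hx.1 hs

/-- The product of `|K|` with a locally compact space carries the topology that is coherent with
the products of the closed simplices with that space. -/
theorem continuous_uncurry_of_continuous_simplexMap {Y Z : Type*} [TopologicalSpace Y]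
    [LocallyCompactSpace Y] [TopologicalSpace Z] {f : K.Realization → Y → Z}
    (h : ∀ (s : Finset V) (hs : s ∈ K.faces),
      Continuous fun p : stdSimplex ℝ s × Y => f (K.simplexMap s hs p.1) p.2) :
    Continuous (Function.uncurry f) := by
  have h1 : ∀ x, Continuous (f x) := fun x => by
    have := (h _ x.2.2.2).comp (Continuous.prodMk_right (Y := Y)
      (⟨fun v => x.1 v, fun v => x.2.1 v, by
        rw [Finset.sum_coe_sort x.1.support fun v => x.1 v]
        exact x.sum_eq_one subset_rfl⟩ : stdSimplex ℝ x.1.support))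
    simp only [Function.comp_def] at this
    rwa [exists_simplexMap_eq x x.2.2.2 subset_rfl] at this
  let F : K.Realization → C(Y, Z) := fun x => ⟨f x, h1 x⟩
  have hF : Continuous F := continuous_of_continuous_simplexMap fun s hs =>
    ContinuousMap.continuous_of_continuous_uncurry _ (h s hs)
  exact ContinuousMap.continuous_uncurry_of_continuous ⟨F, hF⟩

/-! ### Prismatic maps and contractibility -/

/-- The total mass that `x` places on the vertices of rank strictly larger than that of `v`. -/
noncomputable def massAbove (ℓ : V → ℕ) (x : V →₀ ℝ) (v : V) : ℝ :=
  ∑ w ∈ x.support, if ℓ v < ℓ w then x w else 0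

/-- The part of the mass at `v` that belongs to the `t` units of mass of highest rank. -/
noncomputable def topMass (ℓ : V → ℕ) (x : V →₀ ℝ) (t : ℝ) (v : V) : ℝ :=
  max 0 (min (x v) (t - massAbove ℓ x v))

/-- The result of moving the `t` units of mass of highest rank along `φ`. -/
noncomputable def pushTop (ℓ : V → ℕ) (φ : V → V) (x : V →₀ ℝ) (t : ℝ) : V →₀ ℝ :=
  ∑ v ∈ x.support, (Finsupp.single v (x v - topMass ℓ x t v) +
    Finsupp.single (φ v) (topMass ℓ x t v))

section

variable {ℓ : V → ℕ} {φ : V → V} {x : V →₀ ℝ} {t : ℝ}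

theorem massAbove_eq {s : Finset V} (hs : x.support ⊆ s) (v : V) :
    massAbove ℓ x v = ∑ w ∈ s, if ℓ v < ℓ w then x w else 0 :=
  Finset.sum_subset hs fun w _ hw => by simp [Finsupp.notMem_support_iff.1 hw]

theorem topMass_eq_zero {v : V} (hv : x v = 0) : topMass ℓ x t v = 0 := by
  rw [topMass, hv]
  exact max_eq_left (min_le_left _ _)

theorem pushTop_eq {s : Finset V} (hs : x.support ⊆ s) :
    pushTop ℓ φ x t = ∑ v ∈ s, (Finsupp.single v (x v - topMass ℓ x t v) +
      Finsupp.single (φ v) (topMass ℓ x t v)) :=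
  Finset.sum_subset hs fun w _ hw => by
    have := Finsupp.notMem_support_iff.1 hw
    simp [this, topMass_eq_zero this]

theorem topMass_nonneg (v : V) : 0 ≤ topMass ℓ x t v := le_max_left _ _

theorem topMass_le (hx : ∀ v, 0 ≤ x v) (v : V) : topMass ℓ x t v ≤ x v :=
  max_le (hx v) (min_le_left _ _)

theorem massAbove_nonneg (hx : ∀ v, 0 ≤ x v) (v : V) : 0 ≤ massAbove ℓ x v :=
  Finset.sum_nonneg fun w _ => by split_ifs <;> simp [hx]

/-- Mass is moved from the top: a vertex that loses mass does not lie below one that keeps some. -/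
theorem le_of_topMass (hx : ∀ v, 0 ≤ x v) {v w : V} (hv : topMass ℓ x t v ≠ x v)
    (hw : topMass ℓ x t w ≠ 0) : ℓ v ≤ ℓ w := by
  classical
  by_contra! hlt
  have hv0 : x v ≠ 0 := fun h => hv ((topMass_eq_zero h).trans h.symm)
  have h1 : massAbove ℓ x w < t := by
    by_contra! h
    exact hw (max_eq_left ((min_le_right _ _).trans (sub_nonpos.2 h)))
  have h2 : massAbove ℓ x v + x v ≤ massAbove ℓ x w := by
    have hvs : v ∈ x.support := Finsupp.mem_support_iff.2 hv0
    have e : x v = ∑ u ∈ x.support, if u = v then x u else 0 := by simp [hv0]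
    rw [e, massAbove, massAbove, ← Finset.sum_add_distrib]
    refine Finset.sum_le_sum fun u _ => ?_
    by_cases huv : u = v
    · subst huv; simp [hlt]
    · by_cases h : ℓ v < ℓ u
      · simp [huv, h, hlt.trans h]
      · simp only [h, huv, if_false, add_zero]
        split_ifs <;> simp [hx]
  exact hv ((max_eq_right (le_min (hx v) (by linarith [hx v]))).trans
    (min_eq_left (by linarith)))

theorem topMass_of_nonpos (hx : ∀ v, 0 ≤ x v) (ht : t ≤ 0) (v : V) : topMass ℓ x t v = 0 :=
  max_eq_left ((min_le_right _ _).trans (by linarith [massAbove_nonneg (ℓ := ℓ) hx v]))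

theorem topMass_of_one_le (hx : ∀ v, 0 ≤ x v) (h1 : ∑ v ∈ x.support, x v = 1) (ht : 1 ≤ t)
    (v : V) : topMass ℓ x t v = x v := by
  classical
  by_cases hv0 : x v = 0
  · rw [hv0, topMass_eq_zero hv0]
  have h2 : massAbove ℓ x v + x v ≤ 1 := by
    have e : x v = ∑ u ∈ x.support, if u = v then x u else 0 := by simp [hv0]
    rw [e, massAbove, ← h1, ← Finset.sum_add_distrib]
    refine Finset.sum_le_sum fun u _ => ?_
    by_cases huv : u = v
    · subst huv; simp
    · simp only [huv, if_false, add_zero]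
      split_ifs <;> simp [hx]
  exact (max_eq_right (le_min (hx v) (by linarith [hx v]))).trans (min_eq_left (by linarith))

theorem pushTop_nonneg (hx : ∀ v, 0 ≤ x v) (u : V) : 0 ≤ pushTop ℓ φ x t u := by
  rw [pushTop, Finsupp.finsetSum_apply]
  refine Finset.sum_nonneg fun v _ => ?_
  have h1 : 0 ≤ Finsupp.single v (x v - topMass ℓ x t v) :=
    Finsupp.single_nonneg.2 (sub_nonneg.2 (topMass_le hx v))
  have h2 : 0 ≤ Finsupp.single (φ v) (topMass ℓ x t v) :=
    Finsupp.single_nonneg.2 (topMass_nonneg v)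
  exact add_nonneg (h1 u) (h2 u)

theorem sum_pushTop : ((pushTop ℓ φ x t).sum fun _ a => a) = ∑ v ∈ x.support, x v := by
  have h : ∀ y : V →₀ ℝ, (y.sum fun _ a => a) =
      Finsupp.linearCombination ℝ (fun _ : V => (1 : ℝ)) y := by
    intro y; simp [Finsupp.linearCombination_apply]
  rw [h, pushTop, map_sum]
  refine Finset.sum_congr rfl fun v _ => ?_
  simp

theorem pushTop_of_nonpos (hx : ∀ v, 0 ≤ x v) (ht : t ≤ 0) : pushTop ℓ φ x t = x := by
  simp only [pushTop, topMass_of_nonpos hx ht, sub_zero, Finsupp.single_zero, add_zero]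
  exact x.sum_single

open Classical in
theorem support_pushTop_subset :
    (pushTop ℓ φ x t).support ⊆ {v ∈ x.support | topMass ℓ x t v ≠ x v} ∪
      {v ∈ x.support | topMass ℓ x t v ≠ 0}.image φ := by
  intro u hu
  rw [Finsupp.mem_support_iff, pushTop, Finsupp.finsetSum_apply] at hu
  obtain ⟨v, hv, hne⟩ := Finset.exists_ne_zero_of_sum_ne_zero hu
  rw [Finsupp.add_apply, Finsupp.single_apply, Finsupp.single_apply] at hne
  rw [Finset.mem_union, Finset.mem_image]
  by_cases h1 : v = u ∧ topMass ℓ x t v ≠ x v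
  · exact Or.inl (Finset.mem_filter.2 ⟨h1.1 ▸ hv, h1.1 ▸ h1.2⟩)
  · refine Or.inr ⟨v, ?_⟩
    have h3 : (if v = u then x v - topMass ℓ x t v else 0) = 0 := by
      split_ifs with h
      · rw [sub_eq_zero]; by_contra h'; exact h1 ⟨h, Ne.symm h'⟩
      · rfl
    rw [h3, zero_add] at hne
    have h4 : φ v = u := by by_contra h; simp [h] at hne
    rw [if_pos h4] at hne
    exact ⟨Finset.mem_filter.2 ⟨hv, hne⟩, h4⟩

end

open Classical in
/-- The condition that the prism between a face and its image under `φ`, triangulated by means of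
the rank `ℓ`, consists of faces. -/
def IsPrismatic (K : PreAbstractSimplicialComplex V) (ℓ : V → ℕ) (φ : V → V) : Prop :=
  ∀ s ∈ K.faces, ∀ v ∈ s,
    {w ∈ s | ℓ w ≤ ℓ v} ∪ {w ∈ s | ℓ v ≤ ℓ w}.image φ ∈ K.faces

variable {ℓ : V → ℕ} {φ : V → V}

theorem IsPrismatic.support_pushTop_mem (h : K.IsPrismatic ℓ φ) (x : K.Realization) (t : ℝ) :
    (pushTop ℓ φ x.1 t).support ∈ K.faces := by
  classical
  have hne : (pushTop ℓ φ x.1 t).support.Nonempty := by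
    rw [Finsupp.support_nonempty_iff]
    intro h0
    have h1 := sum_pushTop (ℓ := ℓ) (φ := φ) (x := x.1) (t := t)
    rw [h0, Finsupp.sum_zero_index, x.sum_eq_one subset_rfl] at h1
    exact zero_ne_one h1
  have hsub := support_pushTop_subset (ℓ := ℓ) (φ := φ) (x := x.1) (t := t)
  by_cases hm : {v ∈ x.1.support | topMass ℓ x.1 t v ≠ 0}.Nonempty
  · -- The pivot of the prism simplex is a lowest vertex that loses mass.
    obtain ⟨v, hv, hmin⟩ := Finset.exists_min_image _ ℓ hm
    refine (K.isRelLowerSet_faces (h _ x.2.2.2 v (Finset.mem_filter.1 hv).1)).2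
      (hsub.trans (Finset.union_subset_union ?_ (Finset.image_subset_image ?_))) hne
    · intro w hw
      rw [Finset.mem_filter] at hw ⊢
      exact ⟨hw.1, le_of_topMass x.2.1 hw.2 (Finset.mem_filter.1 hv).2⟩
    · intro w hw
      exact Finset.mem_filter.2 ⟨(Finset.mem_filter.1 hw).1, hmin w hw⟩
  · rw [Finset.not_nonempty_iff_eq_empty] at hm
    rw [hm, Finset.image_empty, Finset.union_empty] at hsub
    exact (K.isRelLowerSet_faces x.2.2.2).2 (hsub.trans (Finset.filter_subset _ _)) hne

/-- The homotopy from the identity of `|K|` to the simplicial map induced by `φ` that moves the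
mass along `φ` in the order of decreasing rank. -/
noncomputable def IsPrismatic.homotopy (h : K.IsPrismatic ℓ φ) (x : K.Realization) (t : ℝ) :
    K.Realization :=
  ⟨pushTop ℓ φ x.1 t, pushTop_nonneg x.2.1,
    sum_pushTop.trans (x.sum_eq_one subset_rfl), h.support_pushTop_mem x t⟩

namespace IsPrismatic

theorem homotopy_of_nonpos (h : K.IsPrismatic ℓ φ) (x : K.Realization) {t : ℝ} (ht : t ≤ 0) :
    h.homotopy x t = x :=
  Subtype.ext (pushTop_of_nonpos x.2.1 ht)

open Classical in
theorem support_homotopy_subset (h : K.IsPrismatic ℓ φ) (x : K.Realization) (t : ℝ) {s : Finset V}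
    (hs : x.1.support ⊆ s) : (h.homotopy x t).1.support ⊆ s ∪ s.image φ :=
  support_pushTop_subset.trans (Finset.union_subset_union ((Finset.filter_subset _ _).trans hs)
    (Finset.image_subset_image ((Finset.filter_subset _ _).trans hs)))

open Classical in
theorem support_homotopy_subset_image (h : K.IsPrismatic ℓ φ) (x : K.Realization) {t : ℝ}
    (ht : 1 ≤ t) {s : Finset V} (hs : x.1.support ⊆ s) :
    (h.homotopy x t).1.support ⊆ s.image φ := by
  intro u hu
  rcases Finset.mem_union.1 (support_pushTop_subset hu) with hu | hu
  · exact absurd (topMass_of_one_le x.2.1 (x.sum_eq_one subset_rfl) ht u) (Finset.mem_filter.1 hu).2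
  · exact Finset.image_subset_image ((Finset.filter_subset _ _).trans hs) hu

theorem continuous_homotopy (h : K.IsPrismatic ℓ φ) :
    Continuous (Function.uncurry h.homotopy) := by
  classical
  refine continuous_uncurry_of_continuous_simplexMap fun s hs => ?_
  have hsub : ∀ y, (K.simplexMap s hs y).1.support ⊆ s := support_simplexMap_subset hs
  refine continuous_of_support_subset (s ∪ s.image φ)
    (fun p => h.support_homotopy_subset _ _ (hsub _)) fun u => ?_
  have hcoord : ∀ v, Continuous fun p : stdSimplex ℝ s × ℝ => (K.simplexMap s hs p.1).1 v := by
    intro v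
    by_cases hv : v ∈ s
    · simp only [simplexMap_apply_mem hs _ hv]
      exact (continuous_apply (⟨v, hv⟩ : s)).comp (continuous_subtype_val.comp continuous_fst)
    · simp only [simplexMap_apply_notMem hs _ hv]
      exact continuous_const
  have htop : ∀ v, Continuous fun p : stdSimplex ℝ s × ℝ =>
      topMass ℓ (K.simplexMap s hs p.1).1 p.2 v := by
    intro v
    simp only [topMass, massAbove_eq (hsub _)]
    refine continuous_const.max ((hcoord v).min (continuous_snd.sub ?_))
    refine continuous_finsetSum _ fun w _ => ?_
    split_ifs
    · exact hcoord w
    · exact continuous_const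
  simp only [homotopy, pushTop_eq (hsub _), Finsupp.finsetSum_apply, Finsupp.add_apply,
    Finsupp.single_apply]
  refine continuous_finsetSum _ fun v _ => Continuous.add ?_ ?_
  · split_ifs
    · exact (hcoord v).sub (htop v)
    · exact continuous_const
  · split_ifs
    · exact htop v
    · exact continuous_const

/-- The composite of the first `n` homotopies from the iterates of `φ` to the next ones; the one
with index `k` takes place in the time interval `[k / (k + 1), (k + 1) / (k + 2)]`. -/
noncomputable def stage (h : K.IsPrismatic ℓ φ) : ℕ → K.Realization → ℝ → K.Realization
  | 0, x, _ => x
  | n + 1, x, t => h.homotopy (stage h n x t) ((n + 2) * ((n + 1) * t - n))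

theorem continuous_stage (h : K.IsPrismatic ℓ φ) (n : ℕ) :
    Continuous (Function.uncurry (h.stage n)) := by
  induction n with
  | zero => exact continuous_fst
  | succ n ih =>
    have hc : Continuous fun p : K.Realization × ℝ => ((n : ℝ) + 2) * ((n + 1) * p.2 - n) := by
      fun_prop
    have e : Function.uncurry (h.stage (n + 1)) = Function.uncurry h.homotopy ∘
        fun p => (Function.uncurry (h.stage n) p, ((n : ℝ) + 2) * ((n + 1) * p.2 - n)) := rfl
    rw [e]
    exact h.continuous_homotopy.comp (ih.prodMk hc)

theorem stage_zero (h : K.IsPrismatic ℓ φ) (n : ℕ) (x : K.Realization) : h.stage n x 0 = x := by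
  induction n with
  | zero => rfl
  | succ n ih =>
    rw [stage, ih]
    refine h.homotopy_of_nonpos _ ?_
    have : (0 : ℝ) ≤ n := n.cast_nonneg
    nlinarith

open Classical in
theorem support_stage_subset (h : K.IsPrismatic ℓ φ) (n : ℕ) (x : K.Realization) {t : ℝ}
    (ht : n ≤ (n + 1) * t) {s : Finset V} (hs : x.1.support ⊆ s) :
    (h.stage n x t).1.support ⊆ s.image φ^[n] := by
  induction n with
  | zero => simpa [stage] using hs
  | succ n ih =>
    push_cast at ht
    have hn : (0 : ℝ) ≤ n := n.cast_nonneg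
    have ht1 : (n : ℝ) ≤ (n + 1) * t := by
      by_contra! hlt
      have h1 : t < 1 := by nlinarith
      nlinarith
    have := h.support_homotopy_subset_image (h.stage n x t)
      (t := (n + 2) * ((n + 1) * t - n)) (by nlinarith) (ih ht1)
    rw [Finset.image_image, ← Function.iterate_succ'] at this
    exact this

end IsPrismatic

theorem Realization.eq_of_support_subset_singleton {x y : K.Realization} {b : V}
    (hx : x.1.support ⊆ {b}) (hy : y.1.support ⊆ {b}) : x = y := by
  refine Realization.ext fun v => ?_
  by_cases hv : v = b
  · have h1 := x.sum_eq_one hx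
    have h2 := y.sum_eq_one hy
    rw [Finset.sum_singleton] at h1 h2
    rw [hv, h1, h2]
  · rw [Finsupp.notMem_support_iff.1 fun h => hv (Finset.mem_singleton.1 (hx h)),
      Finsupp.notMem_support_iff.1 fun h => hv (Finset.mem_singleton.1 (hy h))]

/-- If the iterates of a prismatic map `φ` carry every vertex to one fixed vertex `b`, then `|K|`
is contractible. The number of iterates that are needed is not assumed to be bounded. -/
theorem IsPrismatic.contractibleSpace (h : K.IsPrismatic ℓ φ) {b : V} (hb : {b} ∈ K.faces)
    (hφb : φ b = b) (hφ : ∀ s ∈ K.faces, ∀ v ∈ s, ∃ n, φ^[n] v = b) :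
    ContractibleSpace K.Realization := by
  classical
  have hfix : ∀ n, φ^[n] b = b := fun n => Function.iterate_fixed hφb n
  have hface : ∀ s ∈ K.faces, ∃ n, s.image φ^[n] ⊆ {b} := by
    intro s hs
    have hex : ∀ v : s, ∃ n, φ^[n] v = b := fun v => hφ s hs v.1 v.2
    choose N hN using hex
    refine ⟨Finset.univ.sup N, Finset.image_subset_iff.2 fun v hv => Finset.mem_singleton.2 ?_⟩
    obtain ⟨k, hk⟩ := Nat.exists_eq_add_of_le (Finset.le_sup (f := N) (Finset.mem_univ ⟨v, hv⟩))
    rw [hk, add_comm, Function.iterate_add_apply, hN, hfix]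
  -- On a face that is carried to `b` by the `n`-th iterate, the stages from `n` on agree.
  have hstable : ∀ (x : K.Realization) (n m : ℕ) (t : ℝ), n ≤ m →
      x.1.support.image φ^[n] ⊆ {b} → h.stage m x t = h.stage n x t := by
    intro x n m t hnm hx
    -- Where a later homotopy has started, the earlier ones have finished and reached `b`.
    induction m, hnm using Nat.le_induction with
    | base => rfl
    | succ m hnm ih =>
      rw [stage, ← ih]
      by_cases ht : (m : ℝ) ≤ (m + 1) * t
      · have hm : x.1.support.image φ^[m] ⊆ {b} := by
          obtain ⟨k, rfl⟩ := Nat.exists_eq_add_of_le hnm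
          refine Finset.image_subset_iff.2 fun v hv => ?_
          rw [add_comm, Function.iterate_add_apply,
            Finset.mem_singleton.1 (hx (Finset.mem_image_of_mem _ hv)), hfix]
          exact Finset.mem_singleton_self b
        have h1 := (h.support_stage_subset m x ht subset_rfl).trans hm
        refine Realization.eq_of_support_subset_singleton
          ((h.support_homotopy_subset _ _ h1).trans ?_) h1
        simp [hφb]
      · refine h.homotopy_of_nonpos _ ?_
        have : (0 : ℝ) ≤ m := m.cast_nonneg
        nlinarith
  choose N hN using hface
  let b' : K.Realization := K.simplexMap {b} hb (stdSimplex.vertex ⟨b, Finset.mem_singleton_self b⟩)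
  let H : K.Realization → unitInterval → K.Realization := fun x t =>
    h.stage (N _ x.2.2.2) x t
  have hH : Continuous (Function.uncurry H) := by
    refine continuous_uncurry_of_continuous_simplexMap fun s hs => ?_
    have : (fun p : stdSimplex ℝ s × unitInterval => H (K.simplexMap s hs p.1) p.2) =
        fun p => h.stage (N s hs) (K.simplexMap s hs p.1) p.2 := by
      funext p
      have h1 := hN _ (K.simplexMap s hs p.1).2.2.2
      have h2 : (K.simplexMap s hs p.1).1.support.image φ^[N s hs] ⊆ {b} :=
        (Finset.image_subset_image (support_simplexMap_subset hs p.1)).trans (hN s hs)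
      exact (hstable _ _ _ _ (le_max_left _ _) h1).symm.trans
        (hstable _ _ _ _ (le_max_right _ _) h2)
    rw [this]
    exact (h.continuous_stage _).comp
      (((continuous_simplexMap s hs).comp continuous_fst).prodMk
        (continuous_subtype_val.comp continuous_snd))
  rw [contractible_iff_id_nullhomotopic]
  refine ⟨b', ⟨⟨⟨fun p => H p.2 p.1, hH.comp continuous_swap⟩, fun x => ?_, fun x => ?_⟩⟩⟩
  · exact h.stage_zero _ x
  · refine Realization.eq_of_support_subset_singleton
      ((h.support_stage_subset _ x ?_ subset_rfl).trans (hN _ x.2.2.2))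
      (support_simplexMap_subset hb _)
    simp

end PreAbstractSimplicialComplex

/-! ### Sides of hyperplanes and separating sets -/

namespace LinearArrangement

variable {d : ℕ} {A : LinearArrangement d}

/-- A linear form with kernel `H`, provided that `H` is a linear hyperplane. -/
noncomputable def form (H : Submodule ℝ (EuclideanSpace ℝ (Fin d))) :
    EuclideanSpace ℝ (Fin d) →ₗ[ℝ] ℝ :=
  open Classical in if h : ∃ f : EuclideanSpace ℝ (Fin d) →ₗ[ℝ] ℝ, f.ker = H then h.choose else 0

theorem ker_form {H : Submodule ℝ (EuclideanSpace ℝ (Fin d))} (hH : H ∈ A.hyperplanes) :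
    (form H).ker = H := by
  have hd := A.finrank_add_one H hH
  have h : ∃ f : EuclideanSpace ℝ (Fin d) →ₗ[ℝ] ℝ, f.ker = H := by
    have hlt : H < ⊤ := by
      rw [lt_top_iff_ne_top]
      rintro rfl
      rw [finrank_top, finrank_euclideanSpace_fin] at hd
      omega
    obtain ⟨f, hf0, hf⟩ := H.exists_le_ker_of_lt_top hlt
    refine ⟨f, (Submodule.eq_of_le_of_finrank_le hf ?_).symm⟩
    have h1 : Module.finrank ℝ f.ker < d := by
      have := Submodule.finrank_lt (s := f.ker) (fun h => hf0 (LinearMap.ker_eq_top.1 h))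
      rwa [finrank_euclideanSpace_fin] at this
    omega
  rw [form, dif_pos h]
  exact h.choose_spec

theorem mem_iff_form {H : Submodule ℝ (EuclideanSpace ℝ (Fin d))} (hH : H ∈ A.hyperplanes)
    (x : EuclideanSpace ℝ (Fin d)) : x ∈ H ↔ form H x = 0 := by
  conv_lhs => rw [← ker_form hH]
  exact LinearMap.mem_ker

theorem form_ne_zero {x : EuclideanSpace ℝ (Fin d)} (hx : x ∈ A.complement)
    {H : Submodule ℝ (EuclideanSpace ℝ (Fin d))} (hH : H ∈ A.hyperplanes) : form H x ≠ 0 :=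
  fun h => hx H hH ((mem_iff_form hH x).2 h)

theorem continuous_form (H : Submodule ℝ (EuclideanSpace ℝ (Fin d))) : Continuous (form H) :=
  (form H).continuous_of_finiteDimensional

/-- Two points of the complement lie in the same chamber if and only if they lie on the same side
of every hyperplane. -/
theorem mem_connectedComponentIn_iff {x : EuclideanSpace ℝ (Fin d)} (hx : x ∈ A.complement)
    (y : EuclideanSpace ℝ (Fin d)) : y ∈ connectedComponentIn A.complement x ↔
      ∀ H ∈ A.hyperplanes, 0 < form H x * form H y := by
  constructor
  · intro hy H hH
    have hyc := connectedComponentIn_subset _ _ hy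
    by_contra! hle
    -- A nonvanishing continuous function cannot change its sign on a connected set.
    have hconn := isPreconnected_connectedComponentIn (x := x) (F := A.complement)
    have h0 : (0 : ℝ) ∈ (fun z => form H x * form H z) '' connectedComponentIn A.complement x :=
      (hconn.image _ (by have := continuous_form H; fun_prop)).ordConnected.out
        ⟨y, hy, rfl⟩ ⟨x, mem_connectedComponentIn hx, rfl⟩
        ⟨hle, mul_self_nonneg _⟩
    obtain ⟨z, hz, hz0⟩ := h0
    exact mul_ne_zero (form_ne_zero hx hH)
      (form_ne_zero (connectedComponentIn_subset _ _ hz) hH) hz0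
  · intro hy
    let S : Set (EuclideanSpace ℝ (Fin d)) :=
      {z | ∀ H ∈ A.hyperplanes, 0 < form H x * form H z}
    have hconv : Convex ℝ S := by
      intro u hu v hv a b ha hb hab H hH
      have h1 := hu H hH
      have h2 := hv H hH
      rw [map_add, map_smul, map_smul, smul_eq_mul, smul_eq_mul]
      have e : form H x * (a * form H u + b * form H v) =
        a * (form H x * form H u) + b * (form H x * form H v) := by ring
      rw [e]
      rcases ha.eq_or_lt with rfl | ha
      · have : b = 1 := by linarith
        subst this; simpa using h2
      · exact add_pos_of_pos_of_nonneg (mul_pos ha h1) (mul_nonneg hb h2.le)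
    refine hconv.isPreconnected.subset_connectedComponentIn (x := x) ?_ ?_ hy
    · exact fun H hH => mul_self_pos.2 (form_ne_zero hx hH)
    · intro z hz H hH hzH
      have := hz H hH
      rw [(mem_iff_form hH z).1 hzH, mul_zero] at this
      exact lt_irrefl _ this

/-- The chamber of a point of the complement. -/
def chamberOf {x : EuclideanSpace ℝ (Fin d)} (hx : x ∈ A.complement) : A.Chamber :=
  ⟨connectedComponentIn A.complement x, x, hx, rfl⟩

/-- A point of a chamber. -/
noncomputable def Chamber.point (C : A.Chamber) : EuclideanSpace ℝ (Fin d) :=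
  C.isComponent.choose

theorem Chamber.point_mem (C : A.Chamber) : C.point ∈ A.complement :=
  C.isComponent.choose_spec.1

theorem Chamber.carrier_eq (C : A.Chamber) :
    C.carrier = connectedComponentIn A.complement C.point :=
  C.isComponent.choose_spec.2

theorem Chamber.mem_carrier_iff (C : A.Chamber) (y : EuclideanSpace ℝ (Fin d)) :
    y ∈ C.carrier ↔ ∀ H ∈ A.hyperplanes, 0 < form H C.point * form H y := by
  rw [C.carrier_eq, mem_connectedComponentIn_iff C.point_mem]

theorem Chamber.point_mem_carrier (C : A.Chamber) : C.point ∈ C.carrier :=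
  C.carrier_eq ▸ mem_connectedComponentIn C.point_mem

theorem mem_chamberOf {x : EuclideanSpace ℝ (Fin d)} (hx : x ∈ A.complement) :
    x ∈ (chamberOf hx).carrier :=
  mem_connectedComponentIn hx

theorem Chamber.pos_of_mem (C : A.Chamber) {x y : EuclideanSpace ℝ (Fin d)} (hx : x ∈ C.carrier)
    (hy : y ∈ C.carrier) {H} (hH : H ∈ A.hyperplanes) : 0 < form H x * form H y := by
  have h1 := (C.mem_carrier_iff x).1 hx H hH
  have h2 := (C.mem_carrier_iff y).1 hy H hH
  have h3 := mul_pos h1 h2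
  have h4 : 0 ≤ form H C.point * form H C.point := mul_self_nonneg _
  by_contra! h
  nlinarith

theorem Chamber.mem_complement (C : A.Chamber) {x : EuclideanSpace ℝ (Fin d)}
    (hx : x ∈ C.carrier) : x ∈ A.complement := by
  rw [C.carrier_eq] at hx
  exact connectedComponentIn_subset _ _ hx

theorem mem_sep_iff_of_mem {C D : A.Chamber} {p q : EuclideanSpace ℝ (Fin d)}
    (hp : p ∈ C.carrier) (hq : q ∈ D.carrier) {H : Submodule ℝ (EuclideanSpace ℝ (Fin d))} :
    H ∈ sep C D ↔ H ∈ A.hyperplanes ∧ form H p * form H q < 0 := by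
  constructor
  · rintro ⟨hH, p', hp', q', hq', x, ⟨a, b, ha, hb, hab, rfl⟩, hx⟩
    refine ⟨hH, ?_⟩
    rw [mem_iff_form hH, map_add, map_smul, map_smul, smul_eq_mul, smul_eq_mul] at hx
    have h1 := C.pos_of_mem hp hp' hH
    have h2 := D.pos_of_mem hq hq' hH
    have h3 := form_ne_zero (C.mem_complement hp) hH
    have h4 := form_ne_zero (D.mem_complement hq) hH
    by_contra! h
    have h5 : 0 < form H p * form H q := lt_of_le_of_ne h (mul_ne_zero h3 h4).symm
    -- Then all four points lie on the same side of `H`.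
    have h6 : form H p * (a * form H p' + b * form H q') = 0 := by rw [hx, mul_zero]
    have h7 : 0 < form H p * form H q' := by
      have : 0 < (form H p * form H q') * (form H q * form H q) := by nlinarith
      exact pos_of_mul_pos_left this (mul_self_nonneg _)
    rcases ha.eq_or_lt with rfl | ha
    · have : b = 1 := by linarith
      subst this
      nlinarith
    · nlinarith [mul_pos ha h1, mul_nonneg hb h7.le]
  · rintro ⟨hH, hneg⟩
    refine ⟨hH, p, hp, q, hq, ?_⟩
    have hd : form H p - form H q ≠ 0 := by
      intro h
      rw [sub_eq_zero.1 h] at hneg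
      exact absurd (mul_self_nonneg _) (not_le.2 hneg)
    have h0 : (0 : ℝ) ∈ form H '' segment ℝ p q := by
      refine ((convex_segment (𝕜 := ℝ) p q).isPreconnected.image _
        (continuous_form H).continuousOn).ordConnected.uIcc_subset
        ⟨p, left_mem_segment ℝ p q, rfl⟩ ⟨q, right_mem_segment ℝ p q, rfl⟩ ?_
      rw [Set.mem_uIcc]
      rcases mul_neg_iff.1 hneg with h | h
      · exact Or.inr ⟨h.2.le, h.1.le⟩
      · exact Or.inl ⟨h.1.le, h.2.le⟩
    obtain ⟨x, hx, hx0⟩ := h0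
    exact ⟨x, hx, (mem_iff_form hH x).2 hx0⟩

theorem mem_sep_iff {C D : A.Chamber} {H : Submodule ℝ (EuclideanSpace ℝ (Fin d))} :
    H ∈ sep C D ↔ H ∈ A.hyperplanes ∧ form H C.point * form H D.point < 0 :=
  mem_sep_iff_of_mem C.point_mem_carrier D.point_mem_carrier

theorem sep_subset (C D : A.Chamber) : sep C D ⊆ A.hyperplanes := fun _ h => h.1

theorem finite_sep (C D : A.Chamber) : (sep C D).Finite :=
  A.hyperplanes.finite_toSet.subset (sep_subset C D)

theorem sep_comm (C D : A.Chamber) : sep C D = sep D C := by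
  ext H
  rw [mem_sep_iff, mem_sep_iff, mul_comm]

/-- A hyperplane separates `C` from `E` if and only if it separates exactly one of them from `D`. -/
theorem sep_eq_symmDiff (C D E : A.Chamber) : sep C E = symmDiff (sep C D) (sep D E) := by
  ext H
  rw [Set.mem_symmDiff, mem_sep_iff, mem_sep_iff, mem_sep_iff]
  by_cases hH : H ∈ A.hyperplanes
  · simp only [hH, true_and, mul_neg_iff]
    have h1 := form_ne_zero C.point_mem hH
    have h2 := form_ne_zero D.point_mem hH
    have h3 := form_ne_zero E.point_mem hH
    rcases lt_or_gt_of_ne h1 with h1 | h1 <;> rcases lt_or_gt_of_ne h2 with h2 | h2 <;>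
      rcases lt_or_gt_of_ne h3 with h3 | h3 <;> simp [h1, h2, h3, h1.not_gt, h2.not_gt, h3.not_gt]
  · simp [hH]

@[simp]
theorem sep_self (C : A.Chamber) : sep C C = ∅ := by
  rw [sep_eq_symmDiff C C C, symmDiff_self]
  rfl

theorem eq_of_sep_eq_empty {C D : A.Chamber} (h : sep C D = ∅) : C = D := by
  have hsame : ∀ H ∈ A.hyperplanes, 0 < form H C.point * form H D.point := by
    intro H hH
    by_contra! hle
    have : H ∈ sep C D := mem_sep_iff.2 ⟨hH, lt_of_le_of_ne hle
      (mul_ne_zero (form_ne_zero C.point_mem hH) (form_ne_zero D.point_mem hH))⟩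
    rw [h] at this
    exact this
  have hD := (C.mem_carrier_iff D.point).2 hsame
  rw [C.carrier_eq] at hD
  exact Chamber.ext (by rw [C.carrier_eq, D.carrier_eq, connectedComponentIn_eq hD])

/-- Every chamber has an opposite one, from which it is separated by all hyperplanes. -/
theorem exists_opposite (C : A.Chamber) : ∃ D : A.Chamber, sep C D = A.hyperplanes := by
  have hx : -C.point ∈ A.complement := fun H hH h => C.point_mem H hH (by simpa using H.neg_mem h)
  refine ⟨chamberOf hx, (sep_subset _ _).antisymm fun H hH => ?_⟩
  rw [mem_sep_iff_of_mem C.point_mem_carrier (mem_chamberOf hx)]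
  refine ⟨hH, ?_⟩
  rw [map_neg, mul_neg, neg_lt_zero]
  exact mul_self_pos.2 (form_ne_zero C.point_mem hH)

theorem Chamber.isOpen_carrier (C : A.Chamber) : IsOpen C.carrier := by
  have : C.carrier = ⋂ H ∈ A.hyperplanes, {y | 0 < form H C.point * form H y} := by
    ext y
    simp [C.mem_carrier_iff]
  rw [this]
  exact isOpen_biInter_finset fun H _ =>
    isOpen_lt continuous_const (continuous_const.mul (continuous_form H))

/-- For a generic point `q` of `D`, the segment from the chosen point of `C` to `q` meets distinct
hyperplanes in distinct points. -/
theorem exists_generic (C D : A.Chamber) : ∃ q ∈ D.carrier, ∀ H ∈ A.hyperplanes,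
    ∀ H' ∈ A.hyperplanes, form H C.point * form H' q = form H' C.point * form H q → H = H' := by
  classical
  set p := C.point with hp
  let f : Submodule ℝ (EuclideanSpace ℝ (Fin d)) × Submodule ℝ (EuclideanSpace ℝ (Fin d)) →
      EuclideanSpace ℝ (Fin d) →ₗ[ℝ] ℝ := fun P => form P.1 p • form P.2 - form P.2 p • form P.1
  have hnull : ∀ P ∈ A.hyperplanes ×ˢ A.hyperplanes, P.1 ≠ P.2 →
      MeasureTheory.volume (f P).ker.carrier = 0 := by
    intro P hP hne
    obtain ⟨h1, h2⟩ := Finset.mem_product.1 hP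
    refine MeasureTheory.Measure.addHaar_submodule _ _ fun htop => hne ?_
    have h0 : f P = 0 := LinearMap.ker_eq_top.1 htop
    have e : ∀ y, form P.1 p * form P.2 y = form P.2 p * form P.1 y := fun y => by
      have := LinearMap.congr_fun h0 y
      simp only [f, LinearMap.sub_apply, LinearMap.smul_apply, smul_eq_mul,
        LinearMap.zero_apply] at this
      linarith
    have h3 := form_ne_zero C.point_mem h1
    have h4 := form_ne_zero C.point_mem h2
    ext y
    rw [mem_iff_form h1, mem_iff_form h2]
    constructor
    · intro hy
      have := e y
      rw [hy, mul_zero] at this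
      exact (mul_eq_zero.1 this).resolve_left h3
    · intro hy
      have := e y
      rw [hy, mul_zero] at this
      exact (mul_eq_zero.1 this.symm).resolve_left h4
  let T := (A.hyperplanes ×ˢ A.hyperplanes).filter fun P => P.1 ≠ P.2
  have hU : MeasureTheory.volume (⋃ P ∈ (T : Set _), (f P).ker.carrier) = 0 := by
    rw [MeasureTheory.measure_biUnion_null_iff T.countable_toSet]
    exact fun P hP => hnull P (Finset.mem_filter.1 hP).1 (Finset.mem_filter.1 hP).2
  have hpos := D.isOpen_carrier.measure_pos MeasureTheory.volume ⟨_, D.point_mem_carrier⟩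
  obtain ⟨q, hq, hqU⟩ : ∃ q ∈ D.carrier, q ∉ ⋃ P ∈ (T : Set _), (f P).ker.carrier := by
    by_contra! h
    exact hpos.ne' (MeasureTheory.measure_mono_null h hU)
  refine ⟨q, hq, fun H hH H' hH' he => ?_⟩
  by_contra hne
  refine hqU (Set.mem_biUnion (x := (H, H'))
    (Finset.mem_filter.2 ⟨Finset.mem_product.2 ⟨hH, hH'⟩, hne⟩) ?_)
  change f (H, H') q = 0
  simp only [f, LinearMap.sub_apply, LinearMap.smul_apply, smul_eq_mul]
  linarith

/-- Some wall of `C` separates `C` from `D`: the first hyperplane met on the way from `C` to a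
generic point of `D` is one. -/
theorem exists_adjacent_of_ne {C D : A.Chamber} (hne : C ≠ D) :
    ∃ E : A.Chamber, Adjacent C E ∧ sep C E ⊆ sep C D := by
  obtain ⟨q, hq, hgen⟩ := exists_generic C D
  set p := C.point with hp
  have hsep : ∀ H, H ∈ sep C D ↔ H ∈ A.hyperplanes ∧ form H p * form H q < 0 := fun H =>
    mem_sep_iff_of_mem C.point_mem_carrier hq
  let τ : Submodule ℝ (EuclideanSpace ℝ (Fin d)) → ℝ := fun H => form H p / (form H p - form H q)
  have hsne : (sep C D).Nonempty :=
    Set.nonempty_iff_ne_empty.2 fun h => hne (eq_of_sep_eq_empty h)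
  obtain ⟨H₀, hH₀, hmin⟩ := Set.exists_min_image (sep C D) τ (finite_sep C D) hsne
  have hτ : ∀ H ∈ sep C D, form H p - form H q ≠ 0 ∧ 0 < τ H ∧ τ H < 1 ∧
      ∀ t, form H p * (form H p + t * (form H q - form H p)) =
        form H p * (form H p - form H q) * (τ H - t) := by
    intro H hH
    have hneg := ((hsep H).1 hH).2
    have h0 : 0 < form H p * (form H p - form H q) := by nlinarith [mul_self_nonneg (form H p)]
    have h1 : form H p - form H q ≠ 0 := fun h => by rw [h, mul_zero] at h0; exact lt_irrefl _ h0
    refine ⟨h1, ?_, ?_, fun t => ?_⟩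
    · have : τ H = form H p * (form H p - form H q) / (form H p - form H q) ^ 2 := by
        simp only [τ]; field_simp
      rw [this]; positivity
    · have : 1 - τ H = (form H q * form H q - form H p * form H q) / (form H p - form H q) ^ 2 := by
        simp only [τ]; field_simp; ring
      have h2 : 0 < 1 - τ H := by
        rw [this]
        exact div_pos (by nlinarith [mul_self_nonneg (form H q)]) (by positivity)
      linarith
    · simp only [τ]; field_simp; ring
  set t₀ := τ H₀ with ht₀
  obtain ⟨-, h0, h1, hf0⟩ := hτ H₀ hH₀
  have hval : ∀ (H : Submodule ℝ (EuclideanSpace ℝ (Fin d))) (t : ℝ),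
      form H (p + t • (q - p)) = form H p + t * (form H q - form H p) := fun H t => by
    rw [map_add, map_smul, map_sub, smul_eq_mul]
  -- Only `H₀` contains the point of the segment at time `t₀`; a point right after it will do.
  have hother : ∀ H ∈ A.hyperplanes, H ≠ H₀ →
      0 < form H p * (form H p + t₀ * (form H q - form H p)) := by
    intro H hH hHne
    by_cases hHs : H ∈ sep C D
    · obtain ⟨h2, -, -, hf⟩ := hτ H hHs
      obtain ⟨h2', -⟩ := hτ H₀ hH₀
      rw [hf]
      have hneg := ((hsep H).1 hHs).2
      refine mul_pos (by nlinarith [mul_self_nonneg (form H p)])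
        (sub_pos.2 (lt_of_le_of_ne (hmin H hHs) fun he => hHne ?_))
      refine hgen H hH H₀ ((hsep H₀).1 hH₀).1 ?_
      rw [ht₀] at he
      simp only [τ] at he
      rw [div_eq_div_iff h2' h2] at he
      linarith
    · have h2 : 0 ≤ form H p * form H q := by
        by_contra! h
        exact hHs ((hsep H).2 ⟨hH, h⟩)
      have h3 := mul_self_pos.2 (form_ne_zero C.point_mem hH)
      rw [← hp] at h3
      nlinarith [mul_nonneg h0.le h2, mul_pos (sub_pos.2 h1) h3]
  have hev : ∀ᶠ t in nhdsWithin t₀ (Set.Ioi t₀), ∀ H ∈ A.hyperplanes, H ≠ H₀ →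
      0 < form H p * (form H p + t * (form H q - form H p)) := by
    refine Filter.Eventually.filter_mono nhdsWithin_le_nhds ?_
    rw [Filter.eventually_all_finset]
    intro H hH
    by_cases hHne : H = H₀
    · exact Filter.Eventually.of_forall fun t h => absurd hHne h
    · have hc : Continuous fun t : ℝ => form H p * (form H p + t * (form H q - form H p)) := by
        fun_prop
      filter_upwards [hc.continuousAt.eventually (lt_mem_nhds (hother H hH hHne))] with t ht _
      exact ht
  obtain ⟨t, htpos, htgt⟩ := (hev.and self_mem_nhdsWithin).exists
  have hneg : form H₀ p * (form H₀ p + t * (form H₀ q - form H₀ p)) < 0 := by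
    rw [hf0]
    have := ((hsep H₀).1 hH₀).2
    exact mul_neg_of_pos_of_neg (by nlinarith [mul_self_nonneg (form H₀ p)])
      (sub_neg.2 htgt)
  have hx : p + t • (q - p) ∈ A.complement := by
    intro H hH hmem
    rw [mem_iff_form hH, hval] at hmem
    by_cases hHne : H = H₀
    · subst hHne
      rw [hmem, mul_zero] at hneg
      exact lt_irrefl _ hneg
    · have := htpos H hH hHne
      rw [hmem, mul_zero] at this
      exact lt_irrefl _ this
  have hsepE : sep C (chamberOf hx) = {H₀} := by
    ext H
    rw [mem_sep_iff_of_mem C.point_mem_carrier (mem_chamberOf hx), Set.mem_singleton_iff,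
      ← hp, hval]
    constructor
    · rintro ⟨hH, h⟩
      by_contra hHne
      exact lt_asymm h (htpos H hH hHne)
    · rintro rfl
      exact ⟨((hsep H).1 hH₀).1, hneg⟩
  exact ⟨chamberOf hx, ⟨H₀, hsepE⟩, hsepE ▸ Set.singleton_subset_iff.2 hH₀⟩

/-! ### Distances between chambers and positive minimal paths -/

theorem ncard_sep_le_add (C D E : A.Chamber) :
    (sep C E).ncard ≤ (sep C D).ncard + (sep D E).ncard := by
  refine (Set.ncard_le_ncard ?_ ((finite_sep C D).union (finite_sep D E))).trans
    (Set.ncard_union_le _ _)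
  rw [sep_eq_symmDiff C D E]
  exact symmDiff_le_sup

/-- The chamber `D` lies between `C` and `E` if and only if distances add up. -/
theorem sep_subset_iff {C D E : A.Chamber} :
    sep C D ⊆ sep C E ↔ (sep C D).ncard + (sep D E).ncard = (sep C E).ncard := by
  constructor
  · intro h
    have e : sep D E = sep C E \ sep C D := by
      rw [sep_eq_symmDiff D C E, sep_comm D C]
      exact symmDiff_of_le h
    rw [e, add_comm]
    exact Set.ncard_sdiff_add_ncard_of_subset h (finite_sep C E)
  · intro h
    have hsub : sep C E ⊆ sep C D ∪ sep D E := by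
      rw [sep_eq_symmDiff C D E]
      exact symmDiff_le_sup
    have heq := Set.eq_of_subset_of_ncard_le hsub (h ▸ Set.ncard_union_le _ _)
      ((finite_sep C D).union (finite_sep D E))
    rw [heq]
    exact Set.subset_union_left

theorem sep_subset_comm {C D E : A.Chamber} : sep C D ⊆ sep C E ↔ sep E D ⊆ sep E C := by
  rw [sep_subset_iff, sep_subset_iff, sep_comm E D, sep_comm E C, sep_comm D C, add_comm]

theorem ncard_sep_le_length {C D : A.Chamber} (p : Quiver.Path C D) :
    (sep C D).ncard ≤ p.length := by
  induction p with
  | nil => simp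
  | cons p e ih =>
    obtain ⟨H, hH⟩ := e.down
    refine (ncard_sep_le_add _ _ _).trans (add_le_add ih ?_)
    rw [hH, Set.ncard_singleton]

theorem exists_path_length_eq (C D : A.Chamber) :
    ∃ p : Quiver.Path C D, p.length = (sep C D).ncard := by
  induction h : (sep C D).ncard generalizing C with
  | zero =>
    obtain rfl := eq_of_sep_eq_empty ((Set.ncard_eq_zero (finite_sep C D)).1 h)
    exact ⟨Quiver.Path.nil, rfl⟩
  | succ n ih =>
    have hne : C ≠ D := by
      rintro rfl
      simp at h
    obtain ⟨E, hadj, hsub⟩ := exists_adjacent_of_ne hne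
    have hadd := sep_subset_iff.1 hsub
    obtain ⟨H, hH⟩ := hadj
    rw [hH, Set.ncard_singleton] at hadd
    obtain ⟨p, hp⟩ := ih E (by omega)
    refine ⟨(Quiver.Hom.toPath (⟨⟨H, hH⟩⟩ : PLift (Adjacent C E))).comp p, ?_⟩
    rw [Quiver.Path.length_comp, hp, Quiver.Path.length_toPath, add_comm]

theorem isMinimal_iff {C D : A.Chamber} {p : Quiver.Path C D} :
    IsMinimal p ↔ p.length = (sep C D).ncard := by
  refine ⟨fun h => (ncard_sep_le_length p).antisymm' ?_, fun h q => h ▸ ncard_sep_le_length q⟩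
  obtain ⟨q, hq⟩ := exists_path_length_eq C D
  exact hq ▸ h q

/-- The class `(C → D)` of the positive minimal paths from `C` to `D`. -/
noncomputable def minClass (C D : A.Chamber) : posObj C ⟶ posObj D :=
  posClass (exists_path_length_eq C D).choose

theorem posClass_eq_minClass {C D : A.Chamber} {p : Quiver.Path C D}
    (hp : p.length = (sep C D).ncard) : posClass p = minClass C D :=
  CategoryTheory.Quotient.sound _ ⟨isMinimal_iff.2 hp,
    isMinimal_iff.2 (exists_path_length_eq C D).choose_spec⟩

theorem posClass_toPath {C D : A.Chamber} (e : C ⟶ D) :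
    posClass (Quiver.Hom.toPath e) = minClass C D :=
  posClass_eq_minClass (by
    obtain ⟨H, hH⟩ := e.down
    rw [hH, Set.ncard_singleton, Quiver.Path.length_toPath])

theorem posClass_cons {C D E : A.Chamber} (p : Quiver.Path C D) (e : D ⟶ E) :
    posClass (p.cons e) = posClass p ≫ minClass D E :=
  posClass_toPath e ▸ rfl

theorem isPosMin_iff {X Y : A.PosCat} {f : X ⟶ Y} :
    IsPosMin f ↔ f = minClass X.chamber Y.chamber := by
  constructor
  · rintro ⟨p, hp, rfl⟩
    exact posClass_eq_minClass (isMinimal_iff.1 hp)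
  · rintro rfl
    exact ⟨_, isMinimal_iff.2 (exists_path_length_eq _ _).choose_spec, rfl⟩

theorem minClass_comp {C D E : A.Chamber} (h : sep C D ⊆ sep C E) :
    minClass C D ≫ minClass D E = minClass C E := by
  rw [minClass, minClass, ← posClass_comp]
  refine posClass_eq_minClass ?_
  rw [Quiver.Path.length_comp, (exists_path_length_eq C D).choose_spec,
    (exists_path_length_eq D E).choose_spec, sep_subset_iff.1 h]

theorem minClass_self (C : A.Chamber) : minClass C C = 𝟙 (posObj C) :=
  (posClass_eq_minClass (p := Quiver.Path.nil) (by simp)).symm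

/-- The length of a positive path depends only on its class. -/
noncomputable def posLength {X Y : A.PosCat} (f : X ⟶ Y) : ℕ :=
  (exists_posClass f).choose.length

theorem posLength_posClass {C D : A.Chamber} (p : Quiver.Path C D) :
    posLength (posClass p) = p.length :=
  length_eq_of_posClass_eq (exists_posClass (posClass p)).choose_spec

theorem posLength_comp {X Y Z : A.PosCat} (f : X ⟶ Y) (g : Y ⟶ Z) :
    posLength (f ≫ g) = posLength f + posLength g := by
  obtain ⟨p, rfl⟩ := exists_posClass f
  obtain ⟨q, rfl⟩ := exists_posClass g
  have e : posClass p ≫ posClass q = posClass (p.comp q) := rfl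
  erw [e, posLength_posClass, posLength_posClass, posLength_posClass, Quiver.Path.length_comp]

theorem posLength_minClass (C D : A.Chamber) : posLength (minClass C D) = (sep C D).ncard :=
  (posLength_posClass _).trans (exists_path_length_eq C D).choose_spec

/-! ### Full twists and fractions -/

/-- The opposite chamber. -/
noncomputable def Chamber.opp (C : A.Chamber) : A.Chamber := (exists_opposite C).choose

theorem sep_opp (C : A.Chamber) : sep C C.opp = A.hyperplanes := (exists_opposite C).choose_spec

theorem minClass_comp_opp (C D : A.Chamber) :
    minClass C D ≫ minClass D C.opp = minClass C C.opp :=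
  minClass_comp (sep_opp C ▸ sep_subset C D)

theorem minClass_opp_comp (C D : A.Chamber) :
    minClass C.opp D ≫ minClass D C = minClass C.opp C :=
  minClass_comp (by rw [sep_comm _ C, sep_opp]; exact sep_subset _ _)

/-- The full twist `C → -C → C`. -/
noncomputable def fullTwist (C : A.Chamber) : posObj C ⟶ posObj C :=
  minClass C C.opp ≫ minClass C.opp C

theorem minClass_comp_fullTwist (C D : A.Chamber) :
    minClass C D ≫ fullTwist D = fullTwist C ≫ minClass C D := by
  -- Both sides equal `(C → D)(D → -C)(-C → -D)(-D → D)`.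
  rw [fullTwist, fullTwist, Category.assoc, ← minClass_opp_comp C D.opp, Category.assoc,
    minClass_opp_comp D C, ← minClass_comp_opp C D, ← minClass_comp_opp D C.opp, Category.assoc,
    Category.assoc]

/-- Induction on a positive path by appending edges. -/
theorem posInduction {X : A.PosCat} {P : ∀ Y : A.PosCat, (X ⟶ Y) → Prop} (id : P X (𝟙 X))
    (step : ∀ (C D : A.Chamber) (f : X ⟶ posObj C), Adjacent C D → P (posObj C) f →
      P (posObj D) (f ≫ minClass C D)) {Y : A.PosCat} (f : X ⟶ Y) : P Y f := by
  suffices h : ∀ (D : A.Chamber) (p : Quiver.Path X.chamber D), P (posObj D) (posClass p) by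
    obtain ⟨p, rfl⟩ := exists_posClass f
    exact h _ p
  intro D p
  induction p with
  | nil => exact id
  | @cons D E p e ih =>
    exact posClass_cons p e ▸ step D E (posClass p) e.down ih

/-- The full twists form a natural endomorphism of the identity functor. -/
noncomputable def twist (A : LinearArrangement d) : 𝟭 A.PosCat ⟶ 𝟭 A.PosCat where
  app X := fullTwist X.chamber
  naturality X Y f := by
    change f ≫ fullTwist Y.chamber = fullTwist X.chamber ≫ f
    induction f using posInduction with
    | id => exact (Category.id_comp _).trans (Category.comp_id _).symm
    | step C D f _ ih =>
      exact (Category.assoc _ _ _).trans <|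
        (congrArg (f ≫ ·) (minClass_comp_fullTwist C D)).trans <|
        (Category.assoc _ _ _).symm.trans <|
        (congrArg (· ≫ minClass C D) ih).trans (Category.assoc _ _ _)

/-- Every positive path divides, on both sides, a power of the full twist. Only the naturality of
that power matters, so it is recorded as some endomorphism of the identity functor. -/
theorem exists_comp_eq_app {X Y : A.PosCat} (f : X ⟶ Y) :
    ∃ (g : Y ⟶ X) (z : 𝟭 A.PosCat ⟶ 𝟭 A.PosCat), f ≫ g = z.app X ∧ g ≫ f = z.app Y := by
  induction f using posInduction with
  | id => exact ⟨𝟙 _, 𝟙 _, by simp, by simp⟩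
  | step C D f _ ih =>
    obtain ⟨g, z, h1, h2⟩ := ih
    have key : ∀ {U V W : A.PosCat} (f : U ⟶ V) (g : V ⟶ U) (m : V ⟶ W) (m' : W ⟶ V)
        (z t : 𝟭 A.PosCat ⟶ 𝟭 A.PosCat), f ≫ g = z.app U → g ≫ f = z.app V → m ≫ m' = t.app V →
        m' ≫ m = t.app W → (f ≫ m) ≫ m' ≫ g = (z ≫ t).app U ∧
          (m' ≫ g) ≫ f ≫ m = (z ≫ t).app W := by
      intro U V W f g m m' z t h1 h2 h3 h4
      have hz := z.naturality m'
      have ht := t.naturality g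
      simp only [Functor.id_map, Functor.id_obj] at hz ht
      constructor
      · rw [Category.assoc, reassoc_of% h3, ← ht, reassoc_of% h1]; rfl
      · rw [Category.assoc, reassoc_of% h2, reassoc_of% hz, h4]; rfl
    refine ⟨_, _, key f g (minClass C D)
      (minClass D C.opp ≫ minClass C.opp C) z (twist A) h1 h2 ?_ ?_⟩
    · change _ = fullTwist C
      rw [fullTwist, ← minClass_comp_opp C D, Category.assoc]
    · change _ = fullTwist D
      rw [fullTwist, ← minClass_opp_comp C D.opp, Category.assoc, Category.assoc,
        minClass_opp_comp D C, ← minClass_comp_opp D C.opp, Category.assoc]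

/-- Every morphism of the category of positive paths divides a central one, so that the arrangement
groupoid is a category of fractions. -/
theorem hasLeftCalculusOfFractions (A : LinearArrangement d) :
    (⊤ : MorphismProperty A.PosCat).HasLeftCalculusOfFractions where
  exists_leftFraction X Y φ := by
    obtain ⟨g, z, h1, -⟩ := exists_comp_eq_app φ.s
    have hz := z.naturality φ.f
    simp only [Functor.id_map, Functor.id_obj] at hz
    exact ⟨⟨g ≫ φ.f, z.app Y, trivial⟩, by
      change φ.f ≫ z.app Y = φ.s ≫ g ≫ φ.f
      rw [hz, ← h1, Category.assoc]⟩
  ext X' X Y f₁ f₂ s _ h := by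
    obtain ⟨g, z, -, h2⟩ := exists_comp_eq_app s
    have hz1 := z.naturality f₁
    have hz2 := z.naturality f₂
    simp only [Functor.id_map, Functor.id_obj] at hz1 hz2
    exact ⟨Y, z.app Y, trivial, by rw [hz1, hz2, ← h2, Category.assoc, Category.assoc, h]⟩

theorem exists_comp_eq_of_toGroupoid_map_eq {X Y : A.PosCat} {f g : X ⟶ Y}
    (h : A.toGroupoid.map f = A.toGroupoid.map g) :
    ∃ (Z : A.PosCat) (s : Y ⟶ Z), f ≫ s = g ≫ s := by
  have := hasLeftCalculusOfFractions A
  obtain ⟨Z, s, -, hs⟩ := (MorphismProperty.map_eq_iff_postcomp A.toGroupoid ⊤ f g).1 h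
  exact ⟨Z, s, hs⟩

/-! ### Right cancellation -/

theorem exists_path_posClass_eq {C D : A.Chamber} (f : posObj C ⟶ posObj D) :
    ∃ p : Quiver.Path C D, posClass p = f :=
  exists_posClass f

theorem length_of_isMinimal_cons {C D E : A.Chamber} {p : Quiver.Path C D} {e : D ⟶ E}
    (h : IsMinimal (p.cons e)) : p.length = (sep C D).ncard ∧ sep C D ⊆ sep C E := by
  rw [isMinimal_iff, Quiver.Path.length_cons] at h
  obtain ⟨H, hH⟩ := e.down
  have h1 := ncard_sep_le_add C D E
  have h2 := ncard_sep_le_length p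
  have h3 : (sep D E).ncard = 1 := by rw [hH, Set.ncard_singleton]
  refine ⟨by omega, sep_subset_iff.2 (by omega)⟩

/-- Cancelling the edges of `r` one after the other, from the last to the first. -/
theorem cancel_path_of_cancel_edge {B : A.Chamber} {n : ℕ}
    (ih : ∀ (C D : A.Chamber) (p q : Quiver.Path B C) (e : C ⟶ D), p.length < n →
      posClass (p.cons e) = posClass (q.cons e) → posClass p = posClass q)
    {C D : A.Chamber} (p q : Quiver.Path B C) (r : Quiver.Path C D) (hn : p.length + r.length ≤ n)
    (h : posClass (p.comp r) = posClass (q.comp r)) : posClass p = posClass q := by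
  induction r with
  | nil => exact h
  | cons r e ihr =>
    rw [Quiver.Path.length_cons] at hn
    exact ihr (by omega) (ih _ _ (p.comp r) (q.comp r) e
      (by rw [Quiver.Path.length_comp]; omega) h)

/-- If `Y` lies between `X` and `E`, and `D` between `Y` and `E`, then `Y` lies between `X` and
`D`. -/
theorem sep_subset_of_sep_subset {X Y D E : A.Chamber} (h : sep X Y ⊆ sep X E)
    (h' : sep Y D ⊆ sep Y E) : sep X Y ⊆ sep X D := by
  rw [sep_subset_iff] at *
  have h1 := ncard_sep_le_add X D E
  have h2 := ncard_sep_le_add X Y D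
  omega

/-- Property D forces edges to be right cancellable from positive paths that start at the base
chamber. The bound on the length is the induction parameter. -/
theorem PropertyD.cancel_edge {B : A.Chamber} (hD : A.PropertyD B) (n : ℕ) :
    ∀ (C D : A.Chamber) (p q : Quiver.Path B C) (e : C ⟶ D), p.length < n →
      posClass (p.cons e) = posClass (q.cons e) → posClass p = posClass q := by
  induction n with
  | zero => exact fun _ _ _ _ _ h => absurd h (Nat.not_lt_zero _)
  | succ n ih =>
    intro C E p q e hpn hpq
    obtain ⟨X, hX⟩ := hD E (posClass (p.cons e))
    obtain ⟨a, μ, hμ, ha⟩ := (hX X).2 subset_rfl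
    obtain rfl := isPosMin_iff.1 hμ
    obtain ⟨a, rfl⟩ := exists_path_posClass_eq a
    replace ha : posClass (p.cons e) = posClass a ≫ minClass X E := ha
    -- For every path `w.g` in the class of `p.e`, the class of `w` is the one prescribed by the
    -- greatest chamber `X`: this property is invariant under the elementary relations.
    let Q : Quiver.Path B E → Prop := fun u => ∀ (D : A.Chamber) (w : Quiver.Path B D) (g : D ⟶ E),
      u = w.cons g → posClass w = posClass a ≫ minClass X D
    have hstep : ∀ (Y : A.Chamber) (b : Quiver.Path B Y) (r r' : Quiver.Path Y E), IsMinimal r →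
        IsMinimal r' → posClass (b.comp r) = posClass (p.cons e) → Q (b.comp r) →
        Q (b.comp r') := by
      intro Y b r r' hr hr' hbr hQ D' w' g' hw'
      cases r' with
      | nil =>
        have : r.length ≤ 0 := hr Quiver.Path.nil
        obtain rfl := Quiver.Path.eq_nil_of_length_zero r (by omega)
        exact hQ D' w' g' hw'
      | @cons D' _ r' g =>
        obtain ⟨rfl, rfl, hg⟩ := Quiver.Path.cons.inj hw'
        obtain rfl := eq_of_heq hg
        cases r with
        | nil => exact absurd (hr' Quiver.Path.nil) (by simp)
        | @cons D _ r f =>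
          have hlen := length_eq_of_posClass_eq hbr
          rw [Quiver.Path.length_comp, Quiver.Path.length_cons, Quiver.Path.length_cons] at hlen
          obtain ⟨hrl, hrs⟩ := length_of_isMinimal_cons hr
          obtain ⟨hrl', hrs'⟩ := length_of_isMinimal_cons hr'
          have hYE : posClass (r.cons f) = minClass Y E := posClass_eq_minClass (isMinimal_iff.1 hr)
          have hYX : sep X Y ⊆ sep X E := sep_subset_comm.1 ((hX Y).1
            ⟨posClass b, minClass Y E, isPosMin_iff.2 rfl, by rw [← hYE, ← hbr]; rfl⟩)
          have hXD : sep X Y ⊆ sep X D := sep_subset_of_sep_subset hYX hrs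
          have hXD' : sep X Y ⊆ sep X D' := sep_subset_of_sep_subset hYX hrs'
          have h1 : posClass (b.comp r) = posClass a ≫ minClass X D := hQ D (b.comp r) f rfl
          obtain ⟨c, hc⟩ := exists_path_posClass_eq (posClass a ≫ minClass X Y)
          -- Property D puts `Y` below `X`, and cancellation of shorter paths identifies `b`.
          have h2 : posClass b = posClass c := by
            refine cancel_path_of_cancel_edge ih b c r (by omega) ?_
            rw [h1, posClass_comp, hc, posClass_eq_minClass hrl, Category.assoc, minClass_comp hXD]
          rw [posClass_comp, h2, hc, posClass_eq_minClass hrl', Category.assoc, minClass_comp hXD']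
    have hQ : ∀ u v : Quiver.Path B E, posClass u = posClass v → posClass v = posClass (p.cons e) →
        (Q u ↔ Q v) := by
      intro u v huv hv
      have h' : Relation.EqvGen (@HomRel.CompClosure _ _ A.minimalRel B E) u v :=
        Quot.eqvGen_exact huv
      induction h' with
      | rel x y hxy =>
        have aux : ∀ {Y Z : A.Chamber} (b : Quiver.Path B Y) (r r' : Quiver.Path Y Z)
            (g : Quiver.Path Z E), IsMinimal r → IsMinimal r' →
            posClass (b.comp (r.comp g)) = posClass (b.comp (r'.comp g)) →
            posClass (b.comp (r'.comp g)) = posClass (p.cons e) →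
            (Q (b.comp (r.comp g)) ↔ Q (b.comp (r'.comp g))) := by
          intro Y Z b r r' g hr hr' h1 h2
          cases g with
          | nil => exact ⟨hstep Y b r r' hr hr' (h1.trans h2), hstep Y b r' r hr' hr h2⟩
          -- The relation is applied before the last edge, which stays in place.
          | @cons D _ g f =>
            have e1 : posClass (b.comp (r.comp g)) = posClass (b.comp (r'.comp g)) := by
              have : posClass r = posClass r' := (posClass_eq_minClass (isMinimal_iff.1 hr)).trans
                (posClass_eq_minClass (isMinimal_iff.1 hr')).symm
              rw [posClass_comp, posClass_comp, posClass_comp, posClass_comp, this]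
            constructor
            · intro hq D' w' g' hw'
              obtain ⟨rfl, hw, hg⟩ := Quiver.Path.cons.inj hw'
              obtain rfl := eq_of_heq hw
              exact e1.symm.trans (hq D (b.comp (r.comp g)) f rfl)
            · intro hq D' w' g' hw'
              obtain ⟨rfl, hw, hg⟩ := Quiver.Path.cons.inj hw'
              obtain rfl := eq_of_heq hw
              exact e1.trans (hq D (b.comp (r'.comp g)) f rfl)
        obtain ⟨Y, Z, b, r, r', g, hm⟩ := hxy
        exact aux b r r' g hm.1 hm.2 huv hv
      | refl x => exact Iff.rfl
      | symm x y hxy ih' => exact (ih' huv.symm (huv.trans hv)).symm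
      | trans x y z hxy hyz ih₁ ih₂ =>
        have h2 := Quot.eqvGen_sound hyz
        exact (ih₁ (Quot.eqvGen_sound hxy) (h2.trans hv)).trans (ih₂ h2 hv)
    obtain ⟨m, hm⟩ := exists_path_length_eq X E
    have ham : posClass (a.comp m) = posClass (p.cons e) := by
      rw [posClass_comp, posClass_eq_minClass hm]; exact ha.symm
    have hXE : X ≠ E := by
      rintro rfl
      have h1 : sep X C ⊆ sep X X := (hX C).1 ⟨posClass p, minClass C X, isPosMin_iff.2 rfl,
        posClass_cons p e⟩
      rw [sep_self] at h1
      obtain ⟨H, hH⟩ := e.down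
      rw [sep_comm C X, Set.subset_empty_iff.1 h1] at hH
      exact Set.singleton_ne_empty H hH.symm
    have hbase : Q (a.comp m) := by
      intro D w g hw
      cases m with
      | nil => exact absurd rfl hXE
      | @cons D' _ m f =>
        obtain ⟨rfl, hw, hg⟩ := Quiver.Path.cons.inj hw
        obtain rfl := eq_of_heq hw
        rw [posClass_comp, posClass_eq_minClass (length_of_isMinimal_cons (isMinimal_iff.2 hm)).1]
    have hp : Q (p.cons e) := (hQ _ _ ham rfl).1 hbase
    have hq : Q (q.cons e) := (hQ _ _ (ham.trans hpq) hpq.symm).1 hbase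
    exact (hp C p e rfl).trans (hq C q e rfl).symm

/-- Right cancellation of positive paths starting at a base chamber with property D. -/
theorem PropertyD.cancel {B : A.Chamber} (hD : A.PropertyD B) {X Y : A.PosCat}
    {f g : posObj B ⟶ X} {s : X ⟶ Y} (h : f ≫ s = g ≫ s) : f = g := by
  obtain ⟨p, rfl⟩ := exists_posClass f
  obtain ⟨q, rfl⟩ := exists_posClass g
  obtain ⟨r, rfl⟩ := exists_posClass s
  exact cancel_path_of_cancel_edge (hD.cancel_edge _) p q r le_rfl h

/-- Property D at the base chamber embeds the positive paths that start there into the arrangement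
groupoid. -/
theorem PropertyD.toGroupoid_map_injective {B : A.Chamber} (hD : A.PropertyD B) {X : A.PosCat}
    {f g : posObj B ⟶ X} (h : A.toGroupoid.map f = A.toGroupoid.map g) : f = g := by
  obtain ⟨Z, s, hs⟩ := exists_comp_eq_of_toGroupoid_map_eq h
  exact hD.cancel hs

/-! ### Positive paths from the base chamber and the faces of `U⁺` -/

/-- The positive paths starting at `B`, up to equivalence. -/
abbrev PosPath (B : A.Chamber) : Type := Σ C : A.Chamber, (posObj B ⟶ posObj C)

namespace PosPath

variable {B : A.Chamber}

/-- The vertex of `U⁺` that corresponds to a positive path. -/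
def toUVertex (p : PosPath B) : UVertex B := ⟨posObj p.1, A.toGroupoid.map p.2⟩

/-- The relation `q = p μ` with `μ` positive minimal. It is not transitive. -/
def Rel (p q : PosPath B) : Prop := p.2 ≫ minClass p.1 q.1 = q.2

/-- The length of a positive path. -/
noncomputable def length (p : PosPath B) : ℕ := posLength p.2

theorem length_eq_of_rel {p q : PosPath B} (h : Rel p q) :
    length q = length p + (sep p.1 q.1).ncard := by
  rw [length, length, ← h, posLength_comp, posLength_minClass]

theorem eq_of_rel_of_length_le {p q : PosPath B} (h : Rel p q) (hl : length q ≤ length p) :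
    p = q := by
  have h1 := length_eq_of_rel h
  have h2 : p.1 = q.1 :=
    eq_of_sep_eq_empty ((Set.ncard_eq_zero (finite_sep _ _)).1 (by omega))
  obtain ⟨C, f⟩ := p
  obtain ⟨D, g⟩ := q
  obtain rfl : C = D := h2
  have h3 : f ≫ minClass C C = g := h
  rw [minClass_self, Category.comp_id] at h3
  rw [h3]

theorem rel_refl (p : PosPath B) : Rel p p := by
  rw [Rel, minClass_self, Category.comp_id]

theorem rel_of_length_le {p q : PosPath B} (h : Rel p q ∨ Rel q p) (hl : length p ≤ length q) :
    Rel p q := by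
  rcases h with h | h
  · exact h
  · rw [eq_of_rel_of_length_le h hl]
    exact rel_refl _

theorem toUVertex_injective (hD : A.PropertyD B) :
    Function.Injective (toUVertex : PosPath B → UVertex B) := by
  rintro ⟨C, f⟩ ⟨D, g⟩ h
  obtain ⟨h1, h2⟩ := Sigma.mk.inj h
  obtain rfl : C = D := congrArg PosCat.chamber h1
  exact congrArg (Sigma.mk C) (hD.toGroupoid_map_injective (eq_of_heq h2))

theorem exists_toUVertex_eq {v : UVertex B} (hv : v ∈ positiveVertices B) :
    ∃ p : PosPath B, toUVertex p = v := by
  obtain ⟨X, g⟩ := v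
  obtain ⟨f, hf⟩ := hv
  exact ⟨⟨X.chamber, f⟩, Sigma.ext rfl (heq_of_eq hf)⟩

theorem toUVertex_mem (p : PosPath B) : toUVertex p ∈ positiveVertices B := ⟨p.2, rfl⟩

/-- Removing the greatest positive minimal right factor of `p`: the result precedes all paths from
which `p` is reached by a positive minimal path, and is related to them. -/
theorem exists_rel_of_propertyD (hD : A.PropertyD B) (p : PosPath B) :
    ∃ r : PosPath B, Rel r p ∧ ∀ q, Rel q p → Rel r q := by
  obtain ⟨C, f⟩ := p
  obtain ⟨X, hX⟩ := hD C f
  obtain ⟨a, μ, hμ, ha⟩ := (hX X).2 subset_rfl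
  obtain rfl := isPosMin_iff.1 hμ
  refine ⟨⟨X, a⟩, ha.symm, ?_⟩
  rintro ⟨D, g⟩ hq
  have hq' : g ≫ minClass D C = f := hq
  have hsub : sep X D ⊆ sep X C := sep_subset_comm.1
    ((hX D).1 ⟨g, minClass D C, isPosMin_iff.2 rfl, hq'.symm⟩)
  have ha' : f = a ≫ minClass X C := ha
  refine hD.cancel (s := minClass D C) ?_
  change (a ≫ minClass X D) ≫ minClass D C = g ≫ minClass D C
  rw [hq', Category.assoc, minClass_comp hsub, ha']

/-- The positive path without its greatest positive minimal right factor. -/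
noncomputable def beheaded (hD : A.PropertyD B) (p : PosPath B) : PosPath B :=
  (exists_rel_of_propertyD hD p).choose

theorem beheaded_rel (hD : A.PropertyD B) (p : PosPath B) : Rel (beheaded hD p) p :=
  (exists_rel_of_propertyD hD p).choose_spec.1

theorem beheaded_rel_of_rel (hD : A.PropertyD B) {p q : PosPath B} (h : Rel q p) :
    Rel (beheaded hD p) q :=
  (exists_rel_of_propertyD hD p).choose_spec.2 q h

theorem beheaded_rel_beheaded (hD : A.PropertyD B) {p q : PosPath B} (h : Rel q p) :
    Rel (beheaded hD q) (beheaded hD p) :=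
  beheaded_rel_of_rel hD (beheaded_rel_of_rel hD h)

/-- The trivial path at the base chamber. -/
def base (B : A.Chamber) : PosPath B := ⟨B, 𝟙 _⟩

theorem eq_base_or_exists_rel (p : PosPath B) :
    p = base B ∨ ∃ q, Rel q p ∧ length q < length p := by
  obtain ⟨C, f⟩ := p
  obtain ⟨p, rfl⟩ := exists_path_posClass_eq f
  cases p with
  | nil => exact Or.inl rfl
  | @cons D _ p e =>
    refine Or.inr ⟨⟨D, posClass p⟩, (posClass_cons p e).symm, ?_⟩
    rw [length, length, posLength_posClass, posLength_posClass, Quiver.Path.length_cons]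
    exact Nat.lt_succ_self _

theorem beheaded_base (hD : A.PropertyD B) : beheaded hD (base B) = base B := by
  have h1 := length_eq_of_rel (beheaded_rel hD (base B))
  have h0 : length (base B) = 0 := posLength_posClass (A := A) (C := B) Quiver.Path.nil
  exact eq_of_rel_of_length_le (beheaded_rel hD _) (by omega)

theorem exists_iterate_beheaded (hD : A.PropertyD B) (p : PosPath B) :
    ∃ n, (beheaded hD)^[n] p = base B := by
  induction h : length p using Nat.strong_induction_on generalizing p with
  | _ n ih =>
    rcases eq_base_or_exists_rel p with rfl | ⟨q, hq, hlt⟩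
    · exact ⟨0, rfl⟩
    · have h1 := length_eq_of_rel (beheaded_rel_of_rel hD hq)
      obtain ⟨k, hk⟩ := ih (length (beheaded hD p)) (by omega) _ rfl
      exact ⟨k + 1, hk⟩

end PosPath

open PosPath

/-- The simplices of `U⁺` are the finite nonempty sets of positive paths that are pairwise related
by positive minimal paths. -/
theorem mem_faces_UPlus_iff {B : A.Chamber} (hD : A.PropertyD B) {s : Finset (UVertex B)} :
    s ∈ (A.UPlus B).faces ↔ s.Nonempty ∧ (∀ v ∈ s, v ∈ positiveVertices B) ∧
      ∀ p q : PosPath B, toUVertex p ∈ s → toUVertex q ∈ s → Rel p q ∨ Rel q p := by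
  constructor
  · intro hs
    refine ⟨((A.UPlus B).isRelLowerSet_faces hs).1, hs.2, ?_⟩
    obtain ⟨⟨n, F, γ, -, hF, hs⟩, hpos⟩ := hs
    have key : ∀ i j : Fin (n + 1), ∀ h : i ≤ j, IsPosMin (F.map (homOfLE h)) := by
      intro i j h
      have e : F.map (homOfLE (Fin.zero_le (Fin.last n))) =
          F.map (homOfLE (Fin.zero_le i)) ≫ F.map (homOfLE h) ≫
            F.map (homOfLE (Fin.le_last j)) := by
        rw [← F.map_comp, ← F.map_comp]; rfl
      rw [e] at hF
      exact (isPosMin_of_comp _ _ (isPosMin_of_comp _ _ hF).2).1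
    obtain ⟨f, rfl⟩ : ∃ f : posObj B ⟶ F.obj 0, A.toGroupoid.map f = γ := by
      obtain ⟨f, hf⟩ := hpos (stringVertex F γ 0) (by
        rw [← Finset.mem_coe, hs]; exact ⟨0, rfl⟩)
      refine ⟨f, hf.trans ?_⟩
      have e : F.map (homOfLE (Fin.zero_le (0 : Fin (n + 1)))) = 𝟙 (F.obj 0) := F.map_id 0
      change γ ≫ A.toGroupoid.map (F.map (homOfLE (Fin.zero_le 0))) = γ
      rw [e, CategoryTheory.Functor.map_id, Category.comp_id]
    have hmem : ∀ p : PosPath B, toUVertex p ∈ s → ∃ i, p =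
        ⟨(F.obj i).chamber, f ≫ F.map (homOfLE (Fin.zero_le i))⟩ := by
      intro p hp
      rw [← Finset.mem_coe, hs] at hp
      obtain ⟨i, hi⟩ := hp
      refine ⟨i, toUVertex_injective hD (hi.symm.trans ?_)⟩
      exact Sigma.ext rfl (heq_of_eq (A.toGroupoid.map_comp f _).symm)
    have hle : ∀ i j : Fin (n + 1), i ≤ j →
        Rel (B := B) ⟨(F.obj i).chamber, f ≫ F.map (homOfLE (Fin.zero_le i))⟩
          ⟨(F.obj j).chamber, f ≫ F.map (homOfLE (Fin.zero_le j))⟩ := by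
      intro i j hij
      have e : F.map (homOfLE (Fin.zero_le j)) =
          F.map (homOfLE (Fin.zero_le i)) ≫ F.map (homOfLE hij) := by
        rw [← F.map_comp]; rfl
      rw [isPosMin_iff.1 (key i j hij)] at e
      rw [e]
      exact Category.assoc _ _ _
    intro p q hp hq
    obtain ⟨i, rfl⟩ := hmem p hp
    obtain ⟨j, rfl⟩ := hmem q hq
    exact (le_total i j).imp (hle i j) (hle j i)
  · rintro ⟨hne, hpos, hrel⟩
    obtain ⟨n, hn⟩ : ∃ n, s.card = n + 1 := ⟨s.card - 1, by have := hne.card_pos; omega⟩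
    have hex : ∀ v : s, ∃ p : PosPath B, toUVertex p = v := fun v =>
      exists_toUVertex_eq (hpos v v.2)
    choose P hP using hex
    let e : Fin (n + 1) ≃ s := (s.equivFinOfCardEq hn).symm
    let σ := Tuple.sort fun i => length (P (e i))
    let Q : Fin (n + 1) → PosPath B := fun i => P (e (σ i))
    have hmono : Monotone fun i => length (Q i) := Tuple.monotone_sort fun i => length (P (e i))
    have hQs : ∀ i, toUVertex (Q i) ∈ s := fun i => by
      rw [hP]; exact (e (σ i)).2
    have hQ : ∀ i j, i ≤ j → Rel (Q i) (Q j) := fun i j hij =>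
      rel_of_length_le (hrel _ _ (hQs i) (hQs j)) (hmono hij)
    let F : ComposableArrows A.PosCat n :=
      { obj := fun i => posObj (Q i).1
        map := fun {i j} _ => minClass (Q i).1 (Q j).1
        map_id := fun i => minClass_self _
        map_comp := fun {i j k} f g => by
          have h1 := length_eq_of_rel (hQ i j f.le)
          have h2 := length_eq_of_rel (hQ j k g.le)
          have h3 := length_eq_of_rel (hQ i k (f.le.trans g.le))
          exact (minClass_comp (sep_subset_iff.2 (by omega))).symm }
    refine ⟨⟨n, F, A.toGroupoid.map (Q 0).2, fun i => isPosMin_iff.2 rfl, isPosMin_iff.2 rfl, ?_⟩,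
      hpos⟩
    have hv : ∀ i, stringVertex F (A.toGroupoid.map (Q 0).2) i = toUVertex (Q i) := by
      intro i
      refine Sigma.ext rfl (heq_of_eq ?_)
      change A.toGroupoid.map (Q 0).2 ≫ A.toGroupoid.map (minClass (Q 0).1 (Q i).1) =
        A.toGroupoid.map (Q i).2
      rw [← A.toGroupoid.map_comp, hQ 0 i (Fin.zero_le i)]
    ext v
    constructor
    · intro hvs
      refine ⟨σ.symm (e.symm ⟨v, hvs⟩), ?_⟩
      rw [hv]
      simp only [Q, Equiv.apply_symm_apply]
      exact hP _
    · rintro ⟨i, rfl⟩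
      rw [hv]
      exact hQs i

/-- The map on the vertices of `U` induced by removing greatest positive minimal right factors of
positive paths; the other vertices are fixed. -/
noncomputable def beheadVertex {B : A.Chamber} (hD : A.PropertyD B) : UVertex B → UVertex B :=
  Function.extend toUVertex (fun p => toUVertex (beheaded hD p)) id

/-- The length of the vertices of `U` that are positive paths, extended by zero. -/
noncomputable def vertexLength (B : A.Chamber) : UVertex B → ℕ :=
  Function.extend toUVertex PosPath.length 0

section

variable {B : A.Chamber} (hD : A.PropertyD B)

theorem beheadVertex_toUVertex (p : PosPath B) :
    beheadVertex hD (toUVertex p) = toUVertex (beheaded hD p) :=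
  (toUVertex_injective hD).extend_apply _ _ p

theorem vertexLength_toUVertex (hD : A.PropertyD B) (p : PosPath B) :
    vertexLength B (toUVertex p) = PosPath.length p :=
  (toUVertex_injective hD).extend_apply _ _ p

theorem isPrismatic_beheadVertex :
    (A.UPlus B).IsPrismatic (vertexLength B) (beheadVertex hD) := by
  intro s hs v hv
  obtain ⟨-, hpos, hrel⟩ := (mem_faces_UPlus_iff hD).1 hs
  have hlow : ∀ w : UVertex B, (w ∈ s ∧ vertexLength B w ≤ vertexLength B v) ∨
      (∃ u, (u ∈ s ∧ vertexLength B v ≤ vertexLength B u) ∧ beheadVertex hD u = w) →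
      ∃ p : PosPath B, toUVertex p ∈ s ∧
        (w = toUVertex p ∧ PosPath.length p ≤ vertexLength B v ∨
          w = toUVertex (beheaded hD p) ∧ vertexLength B v ≤ PosPath.length p) := by
    rintro w (⟨hws, hwl⟩ | ⟨u, ⟨hus, hul⟩, rfl⟩)
    · obtain ⟨p, rfl⟩ := exists_toUVertex_eq (hpos w hws)
      rw [vertexLength_toUVertex hD] at hwl
      exact ⟨p, hws, Or.inl ⟨rfl, hwl⟩⟩
    · obtain ⟨p, rfl⟩ := exists_toUVertex_eq (hpos u hus)
      rw [vertexLength_toUVertex hD] at hul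
      exact ⟨p, hus, Or.inr ⟨beheadVertex_toUVertex hD p, hul⟩⟩
  refine (mem_faces_UPlus_iff hD).2 ⟨⟨v, ?_⟩, fun w hw => ?_,
    fun p q hp hq => ?_⟩
  · simp only [Finset.mem_union, Finset.mem_filter]
    exact Or.inl ⟨hv, le_rfl⟩
  · simp only [Finset.mem_union, Finset.mem_filter, Finset.mem_image] at hw
    obtain ⟨p, -, ⟨rfl, -⟩ | ⟨rfl, -⟩⟩ := hlow w hw <;> exact toUVertex_mem _
  · simp only [Finset.mem_union, Finset.mem_filter, Finset.mem_image] at hp hq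
    obtain ⟨p', hp', hp⟩ := hlow _ hp
    obtain ⟨q', hq', hq⟩ := hlow _ hq
    have hr := hrel p' q' hp' hq'
    rcases hp with ⟨hp, hpl⟩ | ⟨hp, hpl⟩ <;> rcases hq with ⟨hq, hql⟩ | ⟨hq, hql⟩ <;>
      obtain rfl := toUVertex_injective hD hp <;> obtain rfl := toUVertex_injective hD hq
    · exact hr
    · exact Or.inr (beheaded_rel_of_rel hD (rel_of_length_le hr (hpl.trans hql)))
    · exact Or.inl (beheaded_rel_of_rel hD (rel_of_length_le hr.symm (hql.trans hpl)))
    · exact hr.imp (beheaded_rel_beheaded hD) (beheaded_rel_beheaded hD)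

end

end LinearArrangement

open LinearArrangement in
theorem mainTheorem2 {d : ℕ} (A : LinearArrangement d) (C₀ : A.Chamber)
    (hD : A.PropertyD C₀) : ContractibleSpace (A.UPlus C₀).Realization := by
  have hbase : beheadVertex hD (PosPath.base C₀).toUVertex = (PosPath.base C₀).toUVertex := by
    rw [beheadVertex_toUVertex, PosPath.beheaded_base]
  refine (isPrismatic_beheadVertex hD).contractibleSpace
    (b := (PosPath.base C₀).toUVertex) ?_ hbase fun s hs v hv => ?_
  · refine (mem_faces_UPlus_iff hD).2 ⟨Finset.singleton_nonempty _, fun v hv => ?_,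
      fun p q hp hq => ?_⟩
    · rw [Finset.mem_singleton.1 hv]
      exact PosPath.toUVertex_mem _
    · rw [PosPath.toUVertex_injective hD (Finset.mem_singleton.1 hp),
        PosPath.toUVertex_injective hD (Finset.mem_singleton.1 hq)]
      exact Or.inl (PosPath.rel_refl _)
  · obtain ⟨p, rfl⟩ := PosPath.exists_toUVertex_eq (hs.2 v hv)
    obtain ⟨n, hn⟩ := PosPath.exists_iterate_beheaded hD p
    refine ⟨n, ?_⟩
    have hsemi : Function.Semiconj PosPath.toUVertex (PosPath.beheaded hD) (beheadVertex hD) :=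
      fun p => (beheadVertex_toUVertex hD p).symm
    rw [← hn]
    exact ((hsemi.iterate_right n) p).symm
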